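/- Let $C\in\mathbb N$ and let $\{\mathbf X(t)\}_{t\ge 0}$ be a time-homogeneous Markov counting system with state space $\mathbb Z^C$ and associated multivariate counting process $\mathbf N=(N_{ij})_{i\ne j}$. That is: every $N_{ij}$ is $\mathbb N$-valued, nondecreasing and right-continuous with $N_{ij}(0)=0$; $X_c(t)=X_c(0)+\sum_{i\neq c}N_{ic}(t)-\sum_{j\ne c}N_{cj}(t)$ for every $c$; and given the history of $(\mathbf X,\mathbf N)$ up to time $s$, the law of $\mathbf N(s+h)-\mathbf N(s)$ depends only on $h$ and on $\mathbf X(s)$. Write $\Delta N_{ij}=N_{ij}(t+h)-N_{ij}(t)$. Call $(t,\mathbf x)$ possible if $P(\mathbf X(t)=\mathbf x)>0$; conditioning on $\mathbf X(t)=\mathbf x$ is used only for possible $(t,\mathbf x)$. Assume that the system is stable and conservative: for all possible $(t,\mathbf x)$, $i\ne j$ and $k\ge1$, the finite limits $$q_{ij}(\mathbf x,k)=\lim_{h\downarrow0}\frac{P(\Delta N_{ij}=k,\ \Delta N_{lm}=0\ \forall (l,m)\neq(i,j)\mid \mathbf X(t)=\mathbf x)}{h},\qquad \lambda(\mathbf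 x)=\lim_{h\downarrow0}\frac{1-P(\Delta N_{lm}=0\ \forall (l,m)\mid \mathbf X(t)=\mathbf x)}{h}$$ exist, do not depend on $t$, and satisfy $\lambda(\mathbf x)=\sum_{i\ne j}\sum_{k\ge1}q_{ij}(\mathbf x,k)<\infty$. With $dN_{ij}(s)=N_{ij}(s)-N_{ij}(s-)$, put $\bar Z_{ij}=\sup_{t\le s\le t+\bar h}dN_{ij}(s)$ and $\bar\Lambda=\sup_{t\le s\le t+\bar h}\lambda(\mathbf X(s))$, and assume that for each possible $(t,\mathbf x)$ and each $i\neq j$: * (P3) there is $\bar h>0$ with $E[\bar Z_{ij}\bar\Lambda\mid\mathbf X(t)=\mathbf x]<\infty$; * (P4) there is $\bar h>0$ with $V[\bar Z_{ij}\bar\Lambda\mid\mathbf X(t)=\mathbf x]<\infty$. Fix $i\ne j$. At a possible $(t,\mathbf x)$ the infinitesimal dispersion index is $$D^{ij}(\mathbf x)=\frac{\lim_{h\downarrow0}h^{-1}V[\Delta N_{ij}\mid\mathbf X(t)=\mathbf x]}{\lim_{h\downarrow0}h^{-1}E[\Delta N_{ij}\mid\mathbf X(t)=\mathbf x]},$$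 and $N_{ij}$ is called infinitesimally over-dispersed (equi-dispersed) at $(t,\mathbf x)$ if $\Delta N_{ij}$ has finite conditional second moment for all small $h>0$, both limits exist with nonzero denominator, and $D^{ij}(\mathbf x)>1$ ($=1$). The process $N_{ij}$ is simple if, with probability one, there is no time $s$ with $dN_{ij}(s)\ge2$, and compound if it is not simple. It is simple at the state $\mathbf x$ if, with probability one, there is no time $s$ with $\mathbf X(s-)=\mathbf x$ and $dN_{ij}(s)\ge 2$, and compound at $\mathbf x$ if it is not simple at $\mathbf x$. Call $\mathbf x$ non-degenerate if $q_{ij}(\mathbf x,k)\ne0$ for some $k\ge1$. Then: 1. for every possible $(t,\mathbf x)$, $N_{ij}$ is infinitesimally over-dispersed at $(t,\mathbf x)$ if and only if it is compound at $\mathbf x$; 2. for every possible $(t,\mathbf x)$ with $\mathbf x$ non-degenerate, $N_{ij}$ is infinitesimally equi-dispersed at $(t,\mathbf x)$ if and only if it is simple at $\mathbf x$; 3. $N_{ij}$ is compound if and only if it is infinitesimally over-dispersed at some possible $(t,\mathbf x)$; 4. $N_{ij}$ is simple if and only if it is infinitesimally equi-dispersed at every possible $(t,\mathbf x)$ with $\mathbf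 x$ non-degenerate. -/

import Mathlib

open MeasureTheory ProbabilityTheory Filter Topology
open scoped NNReal ENNReal

noncomputable section

/-- The event types of a system with conditions `0, …, C - 1`: the ordered pairs `(i, j)`, `i ≠ j`.
An event of type `(i, j)` moves one unit from compartment `i` to compartment `j`. -/
abbrev Transition (C : ℕ) : Type := {p : Fin C × Fin C // p.1 ≠ p.2}

/-- The increment `N (t + h) - N t` (below, `N` is always nondecreasing in time). -/
def increment {Ω : Type*} (N : ℝ≥0 → Ω → ℕ) (t h : ℝ≥0) (ω : Ω) : ℕ :=
  N (t + h) ω - N t ω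

/-- The jump `dN(s) = N(s) - N(s-)`: the number of events that occur simultaneously at time `s`. -/
def jump {Ω : Type*} (N : ℝ≥0 → Ω → ℕ) (s : ℝ≥0) (ω : Ω) : ℕ :=
  N s ω - Function.leftLim (fun u => N u ω) s

section System

variable {C : ℕ} {Ω : Type*} [MeasurableSpace Ω]

/-- The sigma-algebra generated by the state process `X` and the counting processes `N` up to
time `s`. -/
abbrev history (X : ℝ≥0 → Ω → (Fin C → ℤ)) (N : Transition C → ℝ≥0 → Ω → ℕ) (s : ℝ≥0) :
    MeasurableSpace Ω :=
  ⨆ u ∈ Set.Iic s, MeasurableSpace.comap (fun ω => (X u ω, fun e => N e u ω)) inferInstance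

/-- `X`, with associated multivariate counting process `N`, is a time homogeneous Markov counting
system under the law `P`.
* Each `N e` is a counting process started at `0`, with nondecreasing right-continuous paths.
* `X` is obtained from `X 0` and `N` by conservation of mass.
* Time homogeneous Markov property: given the history up to time `s`, the increment of the
  multivariate counting process (hence, by conservation of mass, also that of `X`) over
  `[s, s + h]` has a law that depends only on the present state `X s` and on `h`. -/
structure IsMarkovCountingSystem (P : Measure Ω) (X : ℝ≥0 → Ω → (Fin C → ℤ))
    (N : Transition C → ℝ≥0 → Ω → ℕ) : Prop where
  measurable_state : ∀ t, Measurable (X t)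
  measurable_count : ∀ e t, Measurable (N e t)
  count_zero : ∀ e ω, N e 0 ω = 0
  count_mono : ∀ e ω, Monotone fun t => N e t ω
  count_rightCont : ∀ e ω t, ContinuousWithinAt (fun s => N e s ω) (Set.Ici t) t
  conservation : ∀ t ω c, X t ω c = X 0 ω c
      + ∑ e : Transition C with e.1.2 = c, (N e t ω : ℤ)
      - ∑ e : Transition C with e.1.1 = c, (N e t ω : ℤ)
  markov : ∃ p : ℝ≥0 → (Fin C → ℤ) → (Transition C → ℕ) → ℝ≥0∞,
    ∀ (s h : ℝ≥0) (x : Fin C → ℤ) (n : Transition C → ℕ) (A : Set Ω),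
      MeasurableSet[history X N s] A →
        P (A ∩ X s ⁻¹' {x} ∩ {ω | ∀ e, increment (N e) s h ω = n e})
          = P (A ∩ X s ⁻¹' {x}) * p h x n

/-- The states that `X` occupies with positive probability at time `t`; these are the states for
which conditioning on `X t = x` is meaningful. -/
def IsPossible (P : Measure Ω) (X : ℝ≥0 → Ω → (Fin C → ℤ)) (t : ℝ≥0) (x : Fin C → ℤ) : Prop :=
  P (X t ⁻¹' {x}) ≠ 0

/-- The conditional law given `X t = x`. -/
def condState (P : Measure Ω) (X : ℝ≥0 → Ω → (Fin C → ℤ)) (t : ℝ≥0) (x : Fin C → ℤ) :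
    Measure Ω :=
  P[|X t ⁻¹' {x}]

/-- The system is stable and conservative, with infinitesimal probabilities `q e x k` (for events of
type `e`, `k ≥ 1` of them at once, and no events of the other types) and with finite rate function
`lam x`, which is the sum of all infinitesimal probabilities at `x`. -/
structure IsStableConservative (P : Measure Ω) (X : ℝ≥0 → Ω → (Fin C → ℤ))
    (N : Transition C → ℝ≥0 → Ω → ℕ) (q : Transition C → (Fin C → ℤ) → ℕ+ → ℝ≥0)
    (lam : (Fin C → ℤ) → ℝ≥0) : Prop where
  infinitesimal_prob : ∀ t x, IsPossible P X t x → ∀ (e : Transition C) (k : ℕ+),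
    Tendsto (fun h : ℝ≥0 =>
        (condState P X t x).real {ω | increment (N e) t h ω = (k : ℕ) ∧
          ∀ e', e' ≠ e → increment (N e') t h ω = 0} / (h : ℝ))
      (𝓝[>] 0) (𝓝 (q e x k : ℝ))
  rate : ∀ t x, IsPossible P X t x →
    Tendsto (fun h : ℝ≥0 =>
        (1 - (condState P X t x).real {ω | ∀ e, increment (N e) t h ω = 0}) / (h : ℝ))
      (𝓝[>] 0) (𝓝 (lam x : ℝ))
  conservative : ∀ t x, IsPossible P X t x →
    HasSum (fun ek : Transition C × ℕ+ => q ek.1 x ek.2) (lam x)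

/-- `sup_{t ≤ s ≤ t + h} lam (X s)`. -/
def supRate (X : ℝ≥0 → Ω → (Fin C → ℤ)) (lam : (Fin C → ℤ) → ℝ≥0) (t h : ℝ≥0) (ω : Ω) : ℝ≥0∞ :=
  ⨆ s ∈ Set.Icc t (t + h), (lam (X s ω) : ℝ≥0∞)

/-- `sup_{t ≤ s ≤ t + h} dN(s)`, for one counting process `N`. -/
def supJump (N : ℝ≥0 → Ω → ℕ) (t h : ℝ≥0) (ω : Ω) : ℝ≥0∞ :=
  ⨆ s ∈ Set.Icc t (t + h), (jump N s ω : ℝ≥0∞)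

/-- Property P3: locally in time, the product of the two suprema has finite conditional mean. -/
def PropertyP3 (P : Measure Ω) (X : ℝ≥0 → Ω → (Fin C → ℤ)) (N : Transition C → ℝ≥0 → Ω → ℕ)
    (lam : (Fin C → ℤ) → ℝ≥0) : Prop :=
  ∀ t x, IsPossible P X t x → ∀ e : Transition C, ∃ h : ℝ≥0, 0 < h ∧
    ∫⁻ ω, supJump (N e) t h ω * supRate X lam t h ω ∂(condState P X t x) < ∞

/-- Property P4: locally in time, the product of the two suprema has finite conditional variance. -/
def PropertyP4 (P : Measure Ω) (X : ℝ≥0 → Ω → (Fin C → ℤ)) (N : Transition C → ℝ≥0 → Ω → ℕ)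
    (lam : (Fin C → ℤ) → ℝ≥0) : Prop :=
  ∀ t x, IsPossible P X t x → ∀ e : Transition C, ∃ h : ℝ≥0, 0 < h ∧
    evariance (fun ω => (supJump (N e) t h ω * supRate X lam t h ω).toReal)
      (condState P X t x) < ∞

/-- The infinitesimal dispersion index of the counting process `N`, given `X t = x`, exists and
equals `D`: the increments over short intervals have finite second moment, the infinitesimal mean
`m` exists and is not `0`, the infinitesimal variance `v` exists, and `D = v / m`. -/
def HasDispersionIndex (P : Measure Ω) (X : ℝ≥0 → Ω → (Fin C → ℤ)) (N : ℝ≥0 → Ω → ℕ)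
    (t : ℝ≥0) (x : Fin C → ℤ) (D : ℝ) : Prop :=
  (∀ᶠ h in 𝓝[>] (0 : ℝ≥0), MemLp (fun ω => (increment N t h ω : ℝ)) 2 (condState P X t x)) ∧
  ∃ m v : ℝ,
    Tendsto (fun h : ℝ≥0 => (h : ℝ)⁻¹ * ∫ ω, (increment N t h ω : ℝ) ∂(condState P X t x))
      (𝓝[>] 0) (𝓝 m) ∧
    Tendsto (fun h : ℝ≥0 =>
        (h : ℝ)⁻¹ * variance (fun ω => (increment N t h ω : ℝ)) (condState P X t x))
      (𝓝[>] 0) (𝓝 v) ∧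
    m ≠ 0 ∧ D = v / m

/-- Infinitesimal over-dispersion given `X t = x`. -/
def IsOverDispersedAt (P : Measure Ω) (X : ℝ≥0 → Ω → (Fin C → ℤ)) (N : ℝ≥0 → Ω → ℕ)
    (t : ℝ≥0) (x : Fin C → ℤ) : Prop :=
  ∃ D : ℝ, HasDispersionIndex P X N t x D ∧ 1 < D

/-- Infinitesimal equi-dispersion given `X t = x`. -/
def IsEquiDispersedAt (P : Measure Ω) (X : ℝ≥0 → Ω → (Fin C → ℤ)) (N : ℝ≥0 → Ω → ℕ)
    (t : ℝ≥0) (x : Fin C → ℤ) : Prop :=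
  HasDispersionIndex P X N t x 1

/-- A counting process is simple if, with probability one, there is no time at which two or more
events occur simultaneously. -/
def IsSimpleCounting (P : Measure Ω) (N : ℝ≥0 → Ω → ℕ) : Prop :=
  ∀ᵐ ω ∂P, ∀ s, jump N s ω ≤ 1

/-- A counting process is compound if it is not simple. -/
def IsCompoundCounting (P : Measure Ω) (N : ℝ≥0 → Ω → ℕ) : Prop :=
  ¬ IsSimpleCounting P N

/-- `N` is simple at the state `x` if, with probability one, there is no time at which `X` leaves
`x` (that is, `X(s-) = x`) and two or more events of `N` occur simultaneously. -/
def IsSimpleAt (P : Measure Ω) (X : ℝ≥0 → Ω → (Fin C → ℤ)) (N : ℝ≥0 → Ω → ℕ)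
    (x : Fin C → ℤ) : Prop :=
  ∀ᵐ ω ∂P, ∀ s, Function.leftLim (fun u => X u ω) s = x → jump N s ω ≤ 1

/-- `N` is compound at the state `x` if it is not simple at `x`. -/
def IsCompoundAt (P : Measure Ω) (X : ℝ≥0 → Ω → (Fin C → ℤ)) (N : ℝ≥0 → Ω → ℕ)
    (x : Fin C → ℤ) : Prop :=
  ¬ IsSimpleAt P X N x

end System

end

/-! Write m_p(x) for the sum over k ≥ 1 of k^p q(x,k), for the chosen event type (`rateMoment`). Two
facts at a possible state x carry the proof. The infinitesimal mean and variance are m_1(x) and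
m_2(x), so the dispersion index is m_2/m_1 (`tendsto_moments`, `hasDispersionIndex_iff`). And the
process is simple at x exactly when q(x,k) = 0 for all k ≥ 2 (`isSimpleAt_iff`). Since k² > k for k
≥ 2 and m_2 is finite, m_2 > m_1 exactly when some k ≥ 2 has positive rate. The global statements
follow because almost every path jumps only from possible states.

The difficulty is the upper bound for E[ΔN²]/h: rates are unbounded over states, and the limits
defining them are not uniform in the state. Cut [t, t+h] into cells of length d. Given state y at
the start of a cell, the cell contributes about d·m_2(y), plus a cross term with m_1(y) and the
events so far. While nothing has happened y = x, which gives the main term. The other states are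
controlled by `MarkovFrom.exists_dominatesAt`: from y, the first event within time a is a k-fold one
of the chosen type with probability at least a q(y,k)/(1 + aλ(y))
(`MarkovFrom.exists_firstEventSet`), and it forces the product of the two suprema in P4 to be at
least k·max(λ(x), λ(y)). So m_1 and m_2 along the path are dominated by a square-integrable variable
and its square, and the error terms vanish by dominated convergence. The lower bound is of Fatou
type, and the mean follows from the second moment by uniform integrability.

Simplicity uses the same grid. If q(x,k) = 0 for k ≥ 2, the expected number of cells starting at x
with at least two events tends to 0; if q(x,k) > 0, the first event after a visit to x is a k-fold
jump with positive probability. -/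

set_option linter.unusedSectionVars false

/-! ### Path properties: local constancy, left limits, histories, grid cells -/

section Paths

variable {C : ℕ} {Ω : Type*}

/-- The vector of increments over `[s, s + h]` of all the counting processes. -/
def incr (N : Transition C → ℝ≥0 → Ω → ℕ) (s h : ℝ≥0) (ω : Ω) : Transition C → ℕ :=
  fun e => increment (N e) s h ω

variable [MeasurableSpace Ω] {P : Measure Ω} {X : ℝ≥0 → Ω → (Fin C → ℤ)}
  {N : Transition C → ℝ≥0 → Ω → ℕ}

namespace IsMarkovCountingSystem

lemma increment_add (hM : IsMarkovCountingSystem P X N) (e : Transition C) (s u v : ℝ≥0) (ω : Ω) :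
    increment (N e) s (u + v) ω = increment (N e) s u ω + increment (N e) (s + u) v ω := by
  have h1 : N e s ω ≤ N e (s + u) ω := hM.count_mono e ω le_self_add
  have h2 : N e (s + u) ω ≤ N e (s + u + v) ω := hM.count_mono e ω le_self_add
  simp only [increment, ← add_assoc]
  omega

lemma incr_add (hM : IsMarkovCountingSystem P X N) (s u v : ℝ≥0) (ω : Ω) :
    incr N s (u + v) ω = incr N s u ω + incr N (s + u) v ω :=
  funext fun e => hM.increment_add e s u v ω

lemma incr_eq_zero_iff (hM : IsMarkovCountingSystem P X N) {s h : ℝ≥0} {ω : Ω} :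
    incr N s h ω = 0 ↔ ∀ e, N e (s + h) ω = N e s ω := by
  simp only [funext_iff, incr, increment, Pi.zero_apply]
  refine forall_congr' fun e => ?_
  have h1 : N e s ω ≤ N e (s + h) ω := hM.count_mono e ω le_self_add
  omega

lemma state_congr (hM : IsMarkovCountingSystem P X N) {s u : ℝ≥0} {ω : Ω}
    (h : ∀ e, N e u ω = N e s ω) : X u ω = X s ω := by
  funext c
  rw [hM.conservation u ω c, hM.conservation s ω c]
  simp only [h]

lemma state_eq_of_incr (hM : IsMarkovCountingSystem P X N) {s h : ℝ≥0} {ω : Ω}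
    (h0 : incr N s h ω = 0) : X (s + h) ω = X s ω :=
  hM.state_congr (hM.incr_eq_zero_iff.1 h0)

lemma count_le_of_incr (hM : IsMarkovCountingSystem P X N) {s h u : ℝ≥0} {ω : Ω}
    (h0 : incr N s h ω = 0) (hsu : s ≤ u) (hu : u ≤ s + h) (e : Transition C) :
    N e u ω = N e s ω := by
  have := hM.incr_eq_zero_iff.1 h0 e
  have h1 : N e s ω ≤ N e u ω := hM.count_mono e ω hsu
  have h2 : N e u ω ≤ N e (s + h) ω := hM.count_mono e ω hu
  omega

lemma eventually_right (hM : IsMarkovCountingSystem P X N) (s : ℝ≥0) (ω : Ω) :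
    ∀ᶠ u in 𝓝[≥] s, ∀ e, N e u ω = N e s ω := by
  refine eventually_all.2 fun e => ?_
  have := hM.count_rightCont e ω s
  rw [ContinuousWithinAt, nhds_discrete, tendsto_pure] at this
  exact this

lemma eventually_left (hM : IsMarkovCountingSystem P X N) (s : ℝ≥0) (ω : Ω) :
    ∀ᶠ u in 𝓝[<] s, ∀ e, N e u ω = Function.leftLim (fun u => N e u ω) s := by
  refine eventually_all.2 fun e => ?_
  have := (hM.count_mono e ω).tendsto_leftLim s
  rw [nhds_discrete, tendsto_pure] at this
  exact this

lemma neBot_nhdsLT {s : ℝ≥0} (hs : 0 < s) : (𝓝[<] s).NeBot :=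
  nhdsLT_neBot_of_exists_lt ⟨0, hs⟩

lemma eventually_left_state (hM : IsMarkovCountingSystem P X N) {s : ℝ≥0} (hs : 0 < s) (ω : Ω) :
    ∀ᶠ u in 𝓝[<] s, X u ω = Function.leftLim (fun u => X u ω) s := by
  have := neBot_nhdsLT hs
  obtain ⟨v, hv⟩ := (hM.eventually_left s ω).exists
  have key : ∀ᶠ u in 𝓝[<] s, X u ω = X v ω := by
    filter_upwards [hM.eventually_left s ω] with u hu
    exact hM.state_congr fun e => (hu e).trans (hv e).symm
  have hlim : Function.leftLim (fun u => X u ω) s = X v ω :=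
    leftLim_eq_of_tendsto (tendsto_const_nhds.congr' (key.mono fun _ h => h.symm))
  rw [hlim]
  exact key

lemma leftLim_state_of_const (hM : IsMarkovCountingSystem P X N) {s v : ℝ≥0} {ω : Ω} (hvs : v < s)
    (h : ∀ u, v ≤ u → u < s → ∀ e, N e u ω = N e v ω) :
    Function.leftLim (fun u => X u ω) s = X v ω := by
  have := neBot_nhdsLT (pos_of_gt hvs)
  obtain ⟨u, hu, hvu, hus⟩ := ((hM.eventually_left_state (pos_of_gt hvs) ω).and
    (Ico_mem_nhdsLT hvs)).exists
  rw [← hu]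
  exact hM.state_congr (h u hvu hus)

lemma jump_of_const (hM : IsMarkovCountingSystem P X N) {s v : ℝ≥0} {ω : Ω} (hvs : v < s)
    (h : ∀ u, v ≤ u → u < s → ∀ e, N e u ω = N e v ω) (e : Transition C) :
    jump (N e) s ω = N e s ω - N e v ω := by
  have := neBot_nhdsLT (pos_of_gt hvs)
  obtain ⟨u, hu, hvu, hus⟩ := ((hM.eventually_left s ω).and (Ico_mem_nhdsLT hvs)).exists
  rw [jump, ← hu, h u hvu hus]

lemma jump_le (s : ℝ≥0) (ω : Ω) (e : Transition C) : jump (N e) s ω ≤ N e s ω :=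
  Nat.sub_le _ _

/-- At a point with nothing to its left, `leftLim` is by convention the value itself, so time 0
never carries a jump. -/
lemma jump_zero (s : Transition C) (ω : Ω) : jump (N s) 0 ω = 0 := by
  rw [jump, Function.leftLim, if_pos]
  · simp
  · left
    simp

/-- Up to time T the vector of counts stays below its value at T, and the state is a function of the
initial state and this vector. -/
lemma finite_states (hM : IsMarkovCountingSystem P X N) (T : ℝ≥0) (ω : Ω) :
    ((fun u => X u ω) '' Set.Iic T).Finite := by
  have hfin : (Set.Iic (fun e => N e T ω) : Set (Transition C → ℕ)).Finite := Set.finite_Iic _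
  refine (hfin.image fun n c => X 0 ω c
      + ∑ e : Transition C with e.1.2 = c, (n e : ℤ)
      - ∑ e : Transition C with e.1.1 = c, (n e : ℤ)).subset ?_
  rintro _ ⟨u, hu, rfl⟩
  refine ⟨fun e => N e u ω, fun e => hM.count_mono e ω hu, ?_⟩
  funext c
  exact (hM.conservation u ω c).symm

lemma supJump_lt_top (hM : IsMarkovCountingSystem P X N) (e : Transition C) (t h : ℝ≥0) (ω : Ω) :
    supJump (N e) t h ω < ∞ := by
  refine lt_of_le_of_lt (iSup₂_le fun s hs => ?_) (ENNReal.natCast_lt_top (N e (t + h) ω))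
  exact_mod_cast (jump_le s ω e).trans (hM.count_mono e ω hs.2)

/-- The rate may be unbounded over all states, but a path visits finitely many in bounded time.
Hence the `toReal` in `PropertyP4` loses nothing. -/
lemma supRate_lt_top (hM : IsMarkovCountingSystem P X N) (lam : (Fin C → ℤ) → ℝ≥0) (t h : ℝ≥0)
    (ω : Ω) : supRate X lam t h ω < ∞ := by
  have hfin := (hM.finite_states (t + h) ω).image lam
  obtain ⟨B, hB⟩ := hfin.bddAbove
  refine lt_of_le_of_lt (iSup₂_le fun s hs => ?_) (ENNReal.coe_lt_top (r := B))
  exact_mod_cast hB ⟨_, ⟨s, hs.2, rfl⟩, rfl⟩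

lemma measurable_incr (hM : IsMarkovCountingSystem P X N) (s h : ℝ≥0) :
    Measurable (incr N s h) :=
  measurable_pi_lambda _ fun e =>
    (Measurable.of_discrete (f := fun p : ℕ × ℕ => p.1 - p.2)).comp
      ((hM.measurable_count e (s + h)).prodMk (hM.measurable_count e s))

lemma history_le (hM : IsMarkovCountingSystem P X N) (s : ℝ≥0) :
    history X N s ≤ ‹MeasurableSpace Ω› :=
  iSup₂_le fun u _ => Measurable.comap_le
    ((hM.measurable_state u).prodMk (measurable_pi_lambda _ fun e => hM.measurable_count e u))

end IsMarkovCountingSystem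

lemma history_mono {s u : ℝ≥0} (h : s ≤ u) : history X N s ≤ history X N u :=
  iSup₂_mono' fun v hv => ⟨v, le_trans hv h, le_rfl⟩

lemma measurable_history_pair {s u : ℝ≥0} (h : u ≤ s) :
    Measurable[history X N s] fun ω => (X u ω, fun e => N e u ω) :=
  Measurable.of_comap_le
    (le_iSup₂_of_le (f := fun u (_ : u ∈ Set.Iic s) =>
      MeasurableSpace.comap (fun ω => (X u ω, fun e => N e u ω)) inferInstance) u h le_rfl)

lemma measurable_history_state {s u : ℝ≥0} (h : u ≤ s) : Measurable[history X N s] (X u) :=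
  measurable_fst.comp (measurable_history_pair (X := X) (N := N) h)

lemma measurable_history_count {s u : ℝ≥0} (h : u ≤ s) (e : Transition C) :
    Measurable[history X N s] (N e u) :=
  (measurable_pi_apply e).comp (measurable_snd.comp (measurable_history_pair (X := X) (N := N) h))

lemma measurable_history_increment {s u v : ℝ≥0} (h : u + v ≤ s) (e : Transition C) :
    Measurable[history X N s] (increment (N e) u v) :=
  (Measurable.of_discrete (f := fun p : ℕ × ℕ => p.1 - p.2)).comp
    ((measurable_history_count (X := X) (N := N) h e).prodMk
      (measurable_history_count (le_self_add.trans h) e))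

lemma measurable_history_incr {s u v : ℝ≥0} (h : u + v ≤ s) :
    Measurable[history X N s] (incr N u v) :=
  @measurable_pi_lambda _ _ _ (history X N s) _ _ fun e => measurable_history_increment h e

/-- Every point of `(t, t + a]` lies in one of the cells of the uniform grid. -/
lemma exists_cell {t a s : ℝ≥0} (hts : t < s) (hs : s ≤ t + a) {n : ℕ} (hn : 0 < n) :
    ∃ i < n, t + i * (a / n) < s ∧ s ≤ t + i * (a / n) + a / n := by
  have hn' : (n : ℝ≥0) ≠ 0 := by exact_mod_cast hn.ne'
  have hex : ∃ j : ℕ, s ≤ t + j * (a / n) := ⟨n, by rwa [mul_div_cancel₀ _ hn']⟩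
  classical
  obtain ⟨j, hj⟩ : ∃ j, Nat.find hex = j + 1 := by
    refine Nat.exists_eq_succ_of_ne_zero fun h0 => ?_
    have := Nat.find_spec hex
    rw [h0] at this
    simp only [Nat.cast_zero, zero_mul, add_zero] at this
    exact absurd hts (not_lt.2 this)
  refine ⟨j, ?_, ?_, ?_⟩
  · have : Nat.find hex ≤ n := Nat.find_min' hex (by rwa [mul_div_cancel₀ _ hn'])
    omega
  · exact not_le.1 (Nat.find_min hex (by omega))
  · have := Nat.find_spec hex
    rw [hj] at this
    push_cast at this
    rwa [add_mul, one_mul, ← add_assoc] at this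

end Paths
-- Increment laws given the state, and their behaviour over short times
section Kernel

variable {C : ℕ} {Ω : Type*} [MeasurableSpace Ω] {X : ℝ≥0 → Ω → (Fin C → ℤ)}
  {N : Transition C → ℝ≥0 → Ω → ℕ}

/-- From time `t` on, the increments of `N` under `μ` follow the Markov property with the
increment laws `K h x`. -/
def MarkovFrom (X : ℝ≥0 → Ω → (Fin C → ℤ)) (N : Transition C → ℝ≥0 → Ω → ℕ)
    (K : ℝ≥0 → (Fin C → ℤ) → Measure (Transition C → ℕ)) (μ : Measure Ω) (t : ℝ≥0) : Prop :=
  ∀ (s h : ℝ≥0) (x : Fin C → ℤ) (A : Set Ω) (B : Set (Transition C → ℕ)), t ≤ s →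
    MeasurableSet[history X N s] A →
      μ (A ∩ X s ⁻¹' {x} ∩ incr N s h ⁻¹' B) = μ (A ∩ X s ⁻¹' {x}) * K h x B

/-- The configuration in which exactly `k` events occur, all of type `e`. -/
abbrev singleEvent (ek : Transition C × ℕ+) : Transition C → ℕ := Pi.single ek.1 (ek.2 : ℕ)

/-- The increment laws `K h` from a fixed state have infinitesimal probabilities `q` and
total rate `l`. -/
structure IsRegularState (K : ℝ≥0 → Measure (Transition C → ℕ)) (q : Transition C → ℕ+ → ℝ≥0)
    (l : ℝ≥0) : Prop where
  univ : ∀ h, K h Set.univ = 1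
  single : ∀ ek : Transition C × ℕ+,
    Tendsto (fun h : ℝ≥0 => K h {singleEvent ek} / h) (𝓝[>] 0) (𝓝 (q ek.1 ek.2 : ℝ≥0∞))
  event : Tendsto (fun h : ℝ≥0 => K h {0}ᶜ / h) (𝓝[>] 0) (𝓝 (l : ℝ≥0∞))
  hasSum : HasSum (fun ek : Transition C × ℕ+ => q ek.1 ek.2) l

lemma singleEvent_injective : Function.Injective (singleEvent (C := C)) := by
  rintro ⟨e, k⟩ ⟨e', k'⟩ h
  have h1 := congr_fun h e
  have hee : e = e' := by
    by_contra hne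
    simp only [singleEvent, Pi.single_eq_same, Pi.single_eq_of_ne hne] at h1
    exact k.pos.ne' h1
  subst hee
  simp only [singleEvent, Pi.single_eq_same] at h1
  rw [PNat.eq h1]

lemma singleEvent_ne_zero (ek : Transition C × ℕ+) : singleEvent ek ≠ 0 := by
  intro h
  have h1 := congr_fun h ek.1
  simp only [singleEvent, Pi.single_eq_same, Pi.zero_apply] at h1
  exact ek.2.pos.ne' h1

lemma IsMarkovCountingSystem.exists_markovFrom {P : Measure Ω} [IsProbabilityMeasure P]
    (hM : IsMarkovCountingSystem P X N) :
    ∃ K : ℝ≥0 → (Fin C → ℤ) → Measure (Transition C → ℕ), MarkovFrom X N K P 0 := by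
  obtain ⟨p, hp⟩ := hM.markov
  refine ⟨fun h x => Measure.sum fun n => p h x n • Measure.dirac n, ?_⟩
  intro s h x A B _ hA
  have hS : MeasurableSet (A ∩ X s ⁻¹' {x}) :=
    (hM.history_le s _ hA).inter (hM.measurable_state s (measurableSet_singleton x))
  have key : (P.restrict (A ∩ X s ⁻¹' {x})).map (incr N s h)
      = P (A ∩ X s ⁻¹' {x}) • Measure.sum fun n => p h x n • Measure.dirac n := by
    refine Measure.ext_of_singleton fun n => ?_
    rw [Measure.map_apply (hM.measurable_incr s h) (measurableSet_singleton n),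
      Measure.restrict_apply (hM.measurable_incr s h (measurableSet_singleton n)), Set.inter_comm,
      Measure.smul_apply, Measure.sum_apply _ (measurableSet_singleton n)]
    have h1 : incr N s h ⁻¹' {n} = {ω | ∀ e, increment (N e) s h ω = n e} := by
      ext ω
      exact funext_iff
    rw [h1, hp s h x n A hA, smul_eq_mul]
    congr 1
    rw [tsum_eq_single n]
    · simp
    · intro m hm
      simp [hm]
  have hB : MeasurableSet B := B.to_countable.measurableSet
  have := congr_arg (fun ν => ν B) key
  simp only [Measure.map_apply (hM.measurable_incr s h) hB,
    Measure.restrict_apply (hM.measurable_incr s h hB), Measure.smul_apply, smul_eq_mul] at this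
  rw [Set.inter_comm, this]

/-- The conditioning event belongs to the history at every time s ≥ t, so it can be merged into `A`.
-/
lemma MarkovFrom.condState {P : Measure Ω} {K : ℝ≥0 → (Fin C → ℤ) → Measure (Transition C → ℕ)}
    [IsProbabilityMeasure P]
    (hM : IsMarkovCountingSystem P X N) (hK : MarkovFrom X N K P 0) (t : ℝ≥0) (x : Fin C → ℤ) :
    MarkovFrom X N K (condState P X t x) t := by
  intro s h y A B hs hA
  have hm : MeasurableSet (X t ⁻¹' {x}) := hM.measurable_state t (measurableSet_singleton x)
  have hA' : MeasurableSet[history X N s] (X t ⁻¹' {x} ∩ A) :=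
    MeasurableSet.inter (measurable_history_state hs (measurableSet_singleton x)) hA
  rw [_root_.condState, cond_apply hm, cond_apply hm, ← Set.inter_assoc, ← Set.inter_assoc,
    hK s h y _ B zero_le hA', mul_assoc]

lemma condState_incr {P : Measure Ω} {K : ℝ≥0 → (Fin C → ℤ) → Measure (Transition C → ℕ)}
    [IsProbabilityMeasure P]
    (hM : IsMarkovCountingSystem P X N) (hK : MarkovFrom X N K P 0) {t : ℝ≥0} {x : Fin C → ℤ}
    (hp : IsPossible P X t x) (h : ℝ≥0) (B : Set (Transition C → ℕ)) :
    condState P X t x (incr N t h ⁻¹' B) = K h x B := by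
  have hm : MeasurableSet (X t ⁻¹' {x}) := hM.measurable_state t (measurableSet_singleton x)
  have := hK t h x Set.univ B zero_le MeasurableSet.univ
  rw [Set.univ_inter] at this
  rw [condState, cond_apply hm, this, ← mul_assoc, ENNReal.inv_mul_cancel hp (measure_ne_top _ _),
    one_mul]

lemma tendsto_div_ennreal {f : ℝ≥0 → ℝ≥0∞} (hf : ∀ h, f h ≠ ∞) {c : ℝ≥0}
    (h : Tendsto (fun h : ℝ≥0 => (f h).toReal / (h : ℝ)) (𝓝[>] 0) (𝓝 (c : ℝ))) :
    Tendsto (fun h : ℝ≥0 => f h / h) (𝓝[>] 0) (𝓝 (c : ℝ≥0∞)) := by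
  have h1 := ENNReal.tendsto_ofReal h
  rw [ENNReal.ofReal_coe_nnreal] at h1
  refine h1.congr' ?_
  filter_upwards [self_mem_nhdsWithin] with u hu
  rw [ENNReal.ofReal_div_of_pos (by exact_mod_cast hu), ENNReal.ofReal_toReal (hf u),
    ENNReal.ofReal_coe_nnreal]

lemma isRegularState_of_isPossible {P : Measure Ω} [IsProbabilityMeasure P]
    {K : ℝ≥0 → (Fin C → ℤ) → Measure (Transition C → ℕ)}
    {q : Transition C → (Fin C → ℤ) → ℕ+ → ℝ≥0} {lam : (Fin C → ℤ) → ℝ≥0}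
    (hM : IsMarkovCountingSystem P X N) (hSC : IsStableConservative P X N q lam)
    (hK : MarkovFrom X N K P 0) {t : ℝ≥0} {x : Fin C → ℤ} (hp : IsPossible P X t x) :
    IsRegularState (fun h => K h x) (fun e => q e x) (lam x) := by
  have hc : IsProbabilityMeasure (condState P X t x) := cond_isProbabilityMeasure hp
  have huniv : ∀ h, K h x Set.univ = 1 := fun h => by
    rw [← condState_incr hM hK hp h Set.univ]
    simp
  have hfin : ∀ h B, K h x B ≠ ∞ := fun h B =>
    ((measure_mono (Set.subset_univ B)).trans_lt (by rw [huniv]; exact ENNReal.one_lt_top)).ne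
  refine ⟨huniv, fun ⟨e, k⟩ => ?_, ?_, hSC.conservative t x hp⟩
  · refine tendsto_div_ennreal (fun h => hfin h _) ?_
    refine (hSC.infinitesimal_prob t x hp e k).congr fun h => ?_
    rw [← condState_incr hM hK hp h, measureReal_def]
    congr 3
    ext ω
    simp only [Set.mem_ofPred_eq, Set.mem_preimage, Set.mem_singleton_iff, funext_iff, incr]
    constructor
    · rintro ⟨h1, h2⟩ e'
      by_cases he : e' = e
      · subst he
        simp [h1]
      · simp [he, h2 e' he]
    · intro h1
      refine ⟨by simpa using h1 e, fun e' he => by simpa [he] using h1 e'⟩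
  · refine tendsto_div_ennreal (fun h => hfin h _) ?_
    refine (hSC.rate t x hp).congr fun h => ?_
    rw [← condState_incr hM hK hp h, ← measureReal_def, Set.preimage_compl,
      probReal_compl_eq_one_sub (hM.measurable_incr t h (measurableSet_singleton 0))]
    congr 3
    congr 1
    ext ω
    exact funext_iff.symm

/-- Conservativity at work. A finite set `S` of single-type events exhausts the total rate up to a
small amount. All remaining nonzero configurations, mixed types and large jumps included, have
probability K{0}ᶜ minus that of `S`, which is h times the missing rate up to o(h). As φ is bounded,
they cost at most εh. -/
lemma IsRegularState.eventually_lintegral_le {K : ℝ≥0 → Measure (Transition C → ℕ)}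
    {q : Transition C → ℕ+ → ℝ≥0} {l : ℝ≥0} (hR : IsRegularState K q l) {φ : ℕ → ℝ≥0}
    (h0 : φ 0 = 0) {B : ℝ≥0} (hB : ∀ n, φ n ≤ B) (e : Transition C) {ε : ℝ≥0∞} (hε : 0 < ε) :
    ∀ᶠ h : ℝ≥0 in 𝓝[>] 0, ∫⁻ n, φ (n e) ∂K h ≤ h * (∑' k : ℕ+, (φ k : ℝ≥0∞) * q e k + ε) := by
  classical
  have hφe : ∀ ek : Transition C × ℕ+, ek.1 ≠ e → φ (singleEvent ek e) = 0 := fun ek hek => by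
    rw [singleEvent, Pi.single_eq_of_ne (Ne.symm hek), h0]
  have hsum : HasSum (fun ek : Transition C × ℕ+ => (q ek.1 ek.2 : ℝ≥0∞)) l :=
    ENNReal.hasSum_coe.2 hR.hasSum
  have htot : ∑' ek : Transition C × ℕ+, (φ (singleEvent ek e) : ℝ≥0∞) * q ek.1 ek.2
      = ∑' k : ℕ+, (φ k : ℝ≥0∞) * q e k := by
    rw [ENNReal.tsum_prod', tsum_eq_single e]
    · simp [singleEvent]
    · intro e' he'
      refine ENNReal.tsum_eq_zero.2 fun k => ?_
      rw [hφe (e', k) he']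
      simp
  have hfin : ∑' k : ℕ+, (φ k : ℝ≥0∞) * q e k ≠ ∞ := by
    rw [← htot]
    refine ((ENNReal.tsum_le_tsum fun ek =>
      mul_le_mul_left (ENNReal.coe_le_coe.2 (hB _)) _).trans_lt ?_).ne
    rw [ENNReal.tsum_mul_left, hsum.tsum_eq]
    exact ENNReal.mul_lt_top ENNReal.coe_lt_top ENNReal.coe_lt_top
  obtain ⟨S, hS⟩ : ∃ S : Finset (Transition C × ℕ+),
      (B : ℝ≥0∞) * (l - ∑ ek ∈ S, (q ek.1 ek.2 : ℝ≥0∞)) < ε := by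
    have h1 : Tendsto (fun S : Finset (Transition C × ℕ+) =>
        (B : ℝ≥0∞) * (l - ∑ ek ∈ S, (q ek.1 ek.2 : ℝ≥0∞))) atTop (𝓝 (B * (l - l))) :=
      ENNReal.Tendsto.const_mul (ENNReal.Tendsto.sub tendsto_const_nhds hsum
        (Or.inl ENNReal.coe_ne_top)) (Or.inr ENNReal.coe_ne_top)
    rw [tsub_self, mul_zero] at h1
    exact (h1.eventually_lt_const hε).exists
  have hlim : Tendsto (fun h : ℝ≥0 =>
      ∑ ek ∈ S, (φ (singleEvent ek e) : ℝ≥0∞) * (K h {singleEvent ek} / h)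
        + B * (K h {0}ᶜ / h - ∑ ek ∈ S, K h {singleEvent ek} / h)) (𝓝[>] 0)
      (𝓝 (∑ ek ∈ S, (φ (singleEvent ek e) : ℝ≥0∞) * q ek.1 ek.2
        + B * (l - ∑ ek ∈ S, (q ek.1 ek.2 : ℝ≥0∞)))) := by
    refine Tendsto.add (tendsto_finsetSum _ fun ek _ => ENNReal.Tendsto.const_mul (hR.single ek)
      (Or.inr ENNReal.coe_ne_top)) (ENNReal.Tendsto.const_mul (ENNReal.Tendsto.sub hR.event
        (tendsto_finsetSum _ fun ek _ => hR.single ek) (Or.inl ENNReal.coe_ne_top))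
        (Or.inr ENNReal.coe_ne_top))
  have hlt : ∑ ek ∈ S, (φ (singleEvent ek e) : ℝ≥0∞) * q ek.1 ek.2
        + B * (l - ∑ ek ∈ S, (q ek.1 ek.2 : ℝ≥0∞)) < ∑' k : ℕ+, (φ k : ℝ≥0∞) * q e k + ε := by
    have h1 : ∑ ek ∈ S, (φ (singleEvent ek e) : ℝ≥0∞) * q ek.1 ek.2
        ≤ ∑' k : ℕ+, (φ k : ℝ≥0∞) * q e k := htot ▸ ENNReal.sum_le_tsum S
    exact ENNReal.add_lt_add_of_le_of_lt (h1.trans_lt hfin.lt_top).ne h1 hS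
  filter_upwards [hlim.eventually_lt_const hlt, self_mem_nhdsWithin] with h hh hpos
  have hh0 : (h : ℝ≥0∞) ≠ 0 := by exact_mod_cast (ne_of_gt hpos)
  have hfinK : ∀ D, K h D ≠ ∞ := fun D =>
    ((measure_mono (Set.subset_univ D)).trans_lt (by rw [hR.univ]; exact ENNReal.one_lt_top)).ne
  set R : Set (Transition C → ℕ) := {0}ᶜ \ (S.image singleEvent : Finset _) with hRdef
  have hKR : K h R = K h {0}ᶜ - ∑ ek ∈ S, K h {singleEvent ek} := by
    rw [hRdef, measure_sdiff _ (Finset.measurableSet _).nullMeasurableSet (hfinK _),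
      ← sum_measure_singleton, Finset.sum_image fun a _ b _ h => singleEvent_injective h]
    intro n hn
    obtain ⟨ek, -, rfl⟩ := Finset.mem_image.1 (Finset.mem_coe.1 hn)
    exact singleEvent_ne_zero ek
  have hpt : ∀ n : Transition C → ℕ, (φ (n e) : ℝ≥0∞)
      ≤ ∑ ek ∈ S, (φ (singleEvent ek e) : ℝ≥0∞) * ({singleEvent ek} : Set _).indicator 1 n
        + B * R.indicator 1 n := by
    intro n
    by_cases hn0 : n = 0
    · subst hn0
      simp [h0]
    by_cases hn : n ∈ S.image singleEvent
    · obtain ⟨ek, hek, rfl⟩ := Finset.mem_image.1 hn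
      refine le_add_right ?_
      refine le_trans ?_ (Finset.single_le_sum (fun _ _ => zero_le) hek)
      simp
    · have : n ∈ R := ⟨hn0, fun h => hn (Finset.mem_coe.1 h)⟩
      refine le_add_left ?_
      simpa [this] using hB _
  calc ∫⁻ n, φ (n e) ∂K h
      ≤ ∫⁻ n, (∑ ek ∈ S, (φ (singleEvent ek e) : ℝ≥0∞) * ({singleEvent ek} : Set _).indicator 1 n
        + B * R.indicator 1 n) ∂K h := lintegral_mono hpt
    _ = ∑ ek ∈ S, (φ (singleEvent ek e) : ℝ≥0∞) * K h {singleEvent ek} + B * K h R := by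
        rw [lintegral_add_left .of_discrete, lintegral_finsetSum _ fun _ _ => .of_discrete,
          lintegral_const_mul _ .of_discrete, lintegral_indicator_one .of_discrete]
        simp_rw [lintegral_const_mul _ Measurable.of_discrete,
          lintegral_indicator_one (MeasurableSet.of_discrete)]
    _ = h * (∑ ek ∈ S, (φ (singleEvent ek e) : ℝ≥0∞) * (K h {singleEvent ek} / h)
        + B * (K h {0}ᶜ / h - ∑ ek ∈ S, K h {singleEvent ek} / h)) := by
        have h1 : ∀ a : ℝ≥0∞, a / h * h = a := fun a =>
          ENNReal.div_mul_cancel hh0 ENNReal.coe_ne_top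
        rw [mul_comm (h : ℝ≥0∞), add_mul, Finset.sum_mul, mul_assoc (B : ℝ≥0∞), ENNReal.sub_mul fun _ _ =>
          ENNReal.coe_ne_top, Finset.sum_mul, hKR]
        simp only [mul_assoc, h1]
    _ ≤ _ := by gcongr

end Kernel
-- Grids of cells, and the first event after a given time
section Grid

variable {C : ℕ} {Ω : Type*} [MeasurableSpace Ω] {X : ℝ≥0 → Ω → (Fin C → ℤ)}
  {N : Transition C → ℝ≥0 → Ω → ℕ} {P : Measure Ω}
  {K : ℝ≥0 → (Fin C → ℤ) → Measure (Transition C → ℕ)} {μ : Measure Ω} {t : ℝ≥0}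

/-- The Markov property says that two measures agree on the history: the one with density `φ (incr N
s h ω)` on the fiber, and a multiple of `μ` on the fiber. Trimming both to the history passes from
sets `A` to weights `w`. -/
lemma MarkovFrom.lintegral (hM : IsMarkovCountingSystem P X N) (hK : MarkovFrom X N K μ t)
    [IsFiniteMeasure μ] {s : ℝ≥0} (hs : t ≤ s) (h : ℝ≥0) (y : Fin C → ℤ) {w : Ω → ℝ≥0∞}
    (hw : Measurable[history X N s] w) (φ : (Transition C → ℕ) → ℝ≥0∞) :
    ∫⁻ ω in X s ⁻¹' {y}, w ω * φ (incr N s h ω) ∂μ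
      = (∫⁻ ω in X s ⁻¹' {y}, w ω ∂μ) * ∫⁻ n, φ n ∂K h y := by
  have hle := hM.history_le s
  have hS : MeasurableSet (X s ⁻¹' {y}) := hM.measurable_state s (measurableSet_singleton y)
  have hφ : Measurable fun ω => φ (incr N s h ω) :=
    (Measurable.of_discrete (f := φ)).comp (hM.measurable_incr s h)
  have htrim : ((μ.restrict (X s ⁻¹' {y})).withDensity fun ω => φ (incr N s h ω)).trim hle
      = ((∫⁻ n, φ n ∂K h y) • μ.restrict (X s ⁻¹' {y})).trim hle := by
    refine @Measure.ext _ (history X N s) _ _ fun A hA => ?_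
    rw [trim_measurableSet_eq hle hA, trim_measurableSet_eq hle hA,
      withDensity_apply _ (hle _ hA), Measure.restrict_restrict (hle _ hA), Measure.smul_apply,
      Measure.restrict_apply (hle _ hA), smul_eq_mul]
    have hmap : (μ.restrict (A ∩ X s ⁻¹' {y})).map (incr N s h)
        = μ (A ∩ X s ⁻¹' {y}) • K h y := by
      ext B hB
      rw [Measure.map_apply (hM.measurable_incr s h) hB,
        Measure.restrict_apply (hM.measurable_incr s h hB), Set.inter_comm, hK s h y A B hs hA,
        Measure.smul_apply, smul_eq_mul]
    rw [← lintegral_map (μ := μ.restrict (A ∩ X s ⁻¹' {y})) Measurable.of_discrete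
      (hM.measurable_incr s h), hmap, lintegral_smul_measure, smul_eq_mul, mul_comm]
  have h1 := lintegral_trim (μ := (μ.restrict (X s ⁻¹' {y})).withDensity
    fun ω => φ (incr N s h ω)) hle hw
  rw [htrim, lintegral_trim hle hw, lintegral_smul_measure,
    lintegral_withDensity_eq_lintegral_mul _ hφ (hw.mono hle le_rfl), smul_eq_mul] at h1
  rw [mul_comm, h1]
  simp only [Pi.mul_apply, mul_comm]

lemma tendsto_mesh {a : ℝ≥0} (ha : 0 < a) :
    Tendsto (fun n : ℕ => a / ((n + 1 : ℕ) : ℝ≥0)) atTop (𝓝[>] 0) := by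
  refine tendsto_nhdsWithin_iff.2 ⟨?_, Eventually.of_forall fun n => by
    rw [Set.mem_Ioi]; positivity⟩
  rw [← NNReal.tendsto_coe]
  simpa [Function.comp_def] using
    (tendsto_const_div_atTop_nhds_zero_nat (a : ℝ)).comp (tendsto_add_atTop_nat 1)

lemma mul_eq_mul_div_mesh {a : ℝ≥0} (ha : 0 < a) (n : ℕ) (c : ℝ≥0∞) :
    ((n + 1 : ℕ) : ℝ≥0∞) * c = a * (c / (a / ((n + 1 : ℕ) : ℝ≥0) : ℝ≥0)) := by
  have ha' : (a : ℝ≥0∞) ≠ 0 := by exact_mod_cast ha.ne'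
  rw [ENNReal.coe_div (by positivity), ENNReal.coe_natCast, ENNReal.div_eq_inv_mul,
    ENNReal.inv_div (Or.inl (ENNReal.natCast_ne_top _)) (Or.inl (by simp)), ← mul_assoc,
    ENNReal.mul_div_cancel ha' ENNReal.coe_ne_top]

lemma tendsto_mul_mesh {a : ℝ≥0} (ha : 0 < a) {f : ℝ≥0 → ℝ≥0∞} {c : ℝ≥0∞}
    (h : Tendsto (fun h : ℝ≥0 => f h / h) (𝓝[>] 0) (𝓝 c)) :
    Tendsto (fun n : ℕ => ((n + 1 : ℕ) : ℝ≥0∞) * f (a / ((n + 1 : ℕ) : ℝ≥0))) atTop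
      (𝓝 (a * c)) := by
  simp_rw [mul_eq_mul_div_mesh ha]
  exact ENNReal.Tendsto.const_mul (h.comp (tendsto_mesh ha)) (Or.inr ENNReal.coe_ne_top)

/-- The geometric sum S satisfies S·u = 1 - r^m and S ≥ m·r^m; add S to m times the first identity.
This replaces exponential waiting times and is the origin of the factor 1/(1 + aλ). -/
lemma nat_le_geom_sum_mul {r : ℝ≥0∞} {u : ℝ≥0∞} (h : r + u = 1) (m : ℕ) :
    (m : ℝ≥0∞) ≤ (∑ i ∈ Finset.range m, r ^ i) * (1 + m * u) := by
  have hr : r ≠ ∞ := ne_top_of_le_ne_top ENNReal.one_ne_top (h ▸ le_self_add)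
  have hu : u ≠ ∞ := ne_top_of_le_ne_top ENNReal.one_ne_top (h ▸ le_add_self)
  lift r to ℝ≥0 using hr
  lift u to ℝ≥0 using hu
  have h' : (r : ℝ) + u = 1 := by exact_mod_cast h
  suffices (m : ℝ) ≤ (∑ i ∈ Finset.range m, (r : ℝ) ^ i) * (1 + m * u) by exact_mod_cast this
  have hr1 : (r : ℝ) ≤ 1 := by linarith [u.coe_nonneg]
  have hg : (∑ i ∈ Finset.range m, (r : ℝ) ^ i) * (1 - r) = 1 - (r : ℝ) ^ m := by
    have := geom_sum_mul (r : ℝ) m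
    linarith
  have hs : (m : ℝ) * (r : ℝ) ^ m ≤ ∑ i ∈ Finset.range m, (r : ℝ) ^ i := by
    have := Finset.card_nsmul_le_sum (Finset.range m) (fun i => (r : ℝ) ^ i) ((r : ℝ) ^ m)
      fun i hi => pow_le_pow_of_le_one r.coe_nonneg hr1 (Finset.mem_range.1 hi).le
    simpa using this
  have hu' : (u : ℝ) = 1 - r := by linarith
  rw [hu', mul_add, mul_one, mul_left_comm, hg]
  linarith

/-- The first event after time `s` happens in `(s, s + a]`, and it consists of `ek.2` simultaneous
events of type `ek.1`. -/
def firstEventSet (N : Transition C → ℝ≥0 → Ω → ℕ) (s a : ℝ≥0) (ek : Transition C × ℕ+) : Set Ω :=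
  {ω | ∃ τ ∈ Set.Ioc s (s + a), (∀ u, s ≤ u → u < τ → ∀ e, N e u ω = N e s ω) ∧
    ∀ e, N e τ ω = N e s ω + singleEvent ek e}

/-- On the grid of mesh `d`, the first `i` cells after `s` have no event, the next one has
exactly `ek.2` events, of type `ek.1`. -/
def firstCellSet (N : Transition C → ℝ≥0 → Ω → ℕ) (s d : ℝ≥0) (ek : Transition C × ℕ+) (i : ℕ) :
    Set Ω :=
  incr N s (i * d) ⁻¹' {0} ∩ incr N (s + i * d) d ⁻¹' {singleEvent ek}

lemma measurableSet_firstCellSet (hM : IsMarkovCountingSystem P X N) (s d : ℝ≥0)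
    (ek : Transition C × ℕ+) (i : ℕ) : MeasurableSet (firstCellSet N s d ek i) :=
  (hM.measurable_incr _ _ (measurableSet_singleton _)).inter
    (hM.measurable_incr _ _ (measurableSet_singleton _))

lemma disjoint_firstCellSet (hM : IsMarkovCountingSystem P X N) (s d : ℝ≥0)
    (ek : Transition C × ℕ+) :
    Pairwise (Function.onFun Disjoint fun i => firstCellSet N s d ek i) := by
  have aux : ∀ i j, i < j → Disjoint (firstCellSet N s d ek i) (firstCellSet N s d ek j) := by
    intro i j hij
    refine Set.disjoint_left.2 fun ω hi hj => ?_
    have hc := hM.incr_add s (i * d) d ω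
    have h1 : incr N s (i * d + d) ω = 0 := by
      have hle : (i : ℝ≥0) * d + d ≤ j * d := by
        have : ((i + 1 : ℕ) : ℝ≥0) ≤ j := by exact_mod_cast hij
        calc (i : ℝ≥0) * d + d = ((i + 1 : ℕ) : ℝ≥0) * d := by push_cast; ring
          _ ≤ j * d := by gcongr
      rw [hM.incr_eq_zero_iff]
      exact hM.count_le_of_incr hj.1 le_self_add (by gcongr)
    rw [h1, hi.1, hi.2, zero_add] at hc
    exact singleEvent_ne_zero ek hc.symm
  intro i j hij
  rcases lt_or_gt_of_ne hij with h | h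
  · exact aux i j h
  · exact (aux j i h).symm

/-- Without events the state is still `y` at the start of the next cell, so the same one-step law
applies again. -/
lemma MarkovFrom.no_event_grid (hM : IsMarkovCountingSystem P X N) (hK : MarkovFrom X N K μ t)
    {s : ℝ≥0} (hs : t ≤ s) (d : ℝ≥0) (y : Fin C → ℤ) {A : Set Ω}
    (hA : MeasurableSet[history X N s] A) (i : ℕ) :
    μ (A ∩ X s ⁻¹' {y} ∩ incr N s (i * d) ⁻¹' {0}) = μ (A ∩ X s ⁻¹' {y}) * K d y {0} ^ i
      ∧ ∀ B, μ (A ∩ X s ⁻¹' {y} ∩ incr N s (i * d) ⁻¹' {0} ∩ incr N (s + i * d) d ⁻¹' B)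
        = μ (A ∩ X s ⁻¹' {y}) * K d y {0} ^ i * K d y B := by
  have hstate : ∀ i : ℕ, A ∩ X s ⁻¹' {y} ∩ incr N s (i * d) ⁻¹' {0} ∩ X (s + i * d) ⁻¹' {y}
      = A ∩ X s ⁻¹' {y} ∩ incr N s (i * d) ⁻¹' {0} := by
    intro i
    refine Set.inter_eq_left.2 fun ω hω => ?_
    rw [Set.mem_preimage, hM.state_eq_of_incr hω.2]
    exact hω.1.2
  have hmeas : ∀ i : ℕ, MeasurableSet[history X N (s + i * d)]
      (A ∩ X s ⁻¹' {y} ∩ incr N s (i * d) ⁻¹' {0}) := fun i =>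
    MeasurableSet.inter (MeasurableSet.inter (history_mono le_self_add _ hA)
      (measurable_history_state le_self_add (measurableSet_singleton y)))
      (measurable_history_incr le_rfl (measurableSet_singleton 0))
  have hstep : ∀ (i : ℕ) B,
      μ (A ∩ X s ⁻¹' {y} ∩ incr N s (i * d) ⁻¹' {0} ∩ incr N (s + i * d) d ⁻¹' B)
        = μ (A ∩ X s ⁻¹' {y} ∩ incr N s (i * d) ⁻¹' {0}) * K d y B := by
    intro i B
    have := hK (s + i * d) d y _ B (hs.trans le_self_add) (hmeas i)
    rwa [hstate] at this
  have hpow : ∀ i : ℕ, μ (A ∩ X s ⁻¹' {y} ∩ incr N s (i * d) ⁻¹' {0})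
      = μ (A ∩ X s ⁻¹' {y}) * K d y {0} ^ i := by
    intro i
    induction i with
    | zero =>
      rw [Nat.cast_zero, zero_mul, pow_zero, mul_one, Set.inter_eq_left.2]
      intro ω _
      rw [Set.mem_preimage, Set.mem_singleton_iff, hM.incr_eq_zero_iff]
      simp
    | succ i ih =>
      rw [pow_succ, ← mul_assoc, ← ih, ← hstep]
      congr 1
      ext ω
      simp only [Set.mem_inter_iff, Set.mem_preimage, Set.mem_singleton_iff, and_assoc]
      rw [Nat.cast_add, Nat.cast_one, add_mul, one_mul, hM.incr_add]
      simp only [funext_iff, Pi.add_apply, Pi.zero_apply, Nat.add_eq_zero_iff, forall_and]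
  exact ⟨hpow i, fun B => by rw [hstep, hpow]⟩

/-- The grid approximations of `firstEventSet`. -/
def firstGridSet (N : Transition C → ℝ≥0 → Ω → ℕ) (s a : ℝ≥0) (ek : Transition C × ℕ+) (n : ℕ) :
    Set Ω :=
  ⋃ i ∈ Finset.range (n + 1), firstCellSet N s (a / ((n + 1 : ℕ) : ℝ≥0)) ek i

/-- A coarse grid may mistake several events in one cell for a simultaneous one, so arbitrarily fine
grids are needed. The first change occurs at some τ, attained by right-continuity, and the counts
stay constant on some [τ, v). Once the mesh is below v - τ, the right end of the cell containing τ
lies in [τ, v) and shows exactly the jump at τ. -/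
lemma mem_firstEventSet_of_frequently (hM : IsMarkovCountingSystem P X N) {s a : ℝ≥0} (ha : 0 < a)
    {ek : Transition C × ℕ+} {ω : Ω} (h : ∃ᶠ n in atTop, ω ∈ firstGridSet N s a ek n) :
    ω ∈ firstEventSet N s a ek := by
  set S : Set ℝ≥0 := {u | s ≤ u ∧ ∃ e, N e u ω ≠ N e s ω} with hS
  have hcell : ∀ n, ω ∈ firstGridSet N s a ek n → ∃ u v, s ≤ u ∧ u ∉ S ∧ v ∈ S ∧ v ≤ s + a ∧
      v = u + a / ((n + 1 : ℕ) : ℝ≥0) ∧ ∀ e, N e v ω = N e s ω + singleEvent ek e := by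
    intro n hn
    simp only [firstGridSet, Set.mem_iUnion, Finset.mem_range, exists_prop] at hn
    obtain ⟨i, hi, h0, h1⟩ := hn
    set d := a / ((n + 1 : ℕ) : ℝ≥0) with hd
    have hu : ∀ e, N e (s + i * d) ω = N e s ω := hM.incr_eq_zero_iff.1 h0
    have hv : ∀ e, N e (s + i * d + d) ω = N e s ω + singleEvent ek e := by
      intro e
      have h2 : N e (s + i * d) ω ≤ N e (s + i * d + d) ω := hM.count_mono e ω le_self_add
      have h3 := congr_fun (Set.mem_singleton_iff.1 (Set.mem_preimage.1 h1)) e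
      simp only [incr, increment] at h3
      rw [← hu e]
      omega
    refine ⟨s + i * d, s + i * d + d, le_self_add, fun h => ?_, ⟨le_add_right le_self_add, ek.1, ?_⟩,
      ?_, rfl, hv⟩
    · obtain ⟨e, he⟩ := h.2
      exact he (hu e)
    · rw [hv]
      simp [singleEvent]
    · have hle : ((i + 1 : ℕ) : ℝ≥0) ≤ ((n + 1 : ℕ) : ℝ≥0) := by exact_mod_cast hi
      calc s + i * d + d = s + ((i + 1 : ℕ) : ℝ≥0) * d := by push_cast; ring
        _ ≤ s + ((n + 1 : ℕ) : ℝ≥0) * d := by gcongr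
        _ = s + a := by rw [hd, mul_div_cancel₀ _ (by positivity)]
  obtain ⟨n₀, hn₀⟩ := h.exists
  obtain ⟨_, v₀, -, -, hv₀S, hv₀a, -⟩ := hcell n₀ hn₀
  set τ := sInf S with hτ
  have hconst : ∀ u, s ≤ u → u < τ → ∀ e, N e u ω = N e s ω := by
    intro u hsu huτ e
    by_contra hne
    exact notMem_of_lt_csInf huτ (OrderBot.bddBelow S) ⟨hsu, e, hne⟩
  have hsτ' : s ≤ τ := le_csInf ⟨v₀, hv₀S⟩ fun u hu => hu.1
  obtain ⟨v, hτv, hv⟩ : ∃ v, τ < v ∧ ∀ u, τ ≤ u → u < v → ∀ e, N e u ω = N e τ ω := by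
    obtain ⟨v, hv, hsub⟩ := mem_nhdsGE_iff_exists_Ico_subset.1 (hM.eventually_right τ ω)
    exact ⟨v, hv, fun u h1 h2 => hsub ⟨h1, h2⟩⟩
  have hτS : τ ∈ S := by
    obtain ⟨u, huS, huv⟩ := exists_lt_of_csInf_lt ⟨v₀, hv₀S⟩ hτv
    obtain ⟨e, he⟩ := huS.2
    exact ⟨hsτ', e, by rwa [← hv u (csInf_le (OrderBot.bddBelow S) huS) huv e]⟩
  have hsτ : s < τ := by
    refine lt_of_le_of_ne hsτ' fun heq => ?_
    obtain ⟨e, he⟩ := hτS.2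
    rw [← heq] at he
    exact he rfl
  refine ⟨τ, ⟨hsτ, (csInf_le (OrderBot.bddBelow S) hv₀S).trans hv₀a⟩, hconst, ?_⟩
  have hmesh : ∀ᶠ n : ℕ in atTop, a / ((n + 1 : ℕ) : ℝ≥0) < v - τ :=
    ((tendsto_mesh ha).mono_right nhdsWithin_le_nhds).eventually_lt_const (tsub_pos_of_lt hτv)
  obtain ⟨n, hn, hnv⟩ := (h.and_eventually hmesh).exists
  obtain ⟨u, w, hsu, huS, hwS, -, hw, hwe⟩ := hcell n hn
  have huτ : u < τ := by
    by_contra! hle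
    refine huS ⟨hsu, ?_⟩
    obtain ⟨e, he⟩ := hτS.2
    refine ⟨e, fun heq => he (le_antisymm ?_ (hM.count_mono e ω hsτ'))⟩
    rw [← heq]
    exact hM.count_mono e ω hle
  have hwτ : τ ≤ w := csInf_le (OrderBot.bddBelow S) hwS
  have hwv : w < v := by
    rw [hw]
    calc u + a / ((n + 1 : ℕ) : ℝ≥0) < τ + (v - τ) := add_lt_add huτ hnv
      _ = v := add_tsub_cancel_of_le hτv.le
  intro e
  rw [← hv w hwτ hwv e, hwe e]

/-- Lower bound for the probability that the first event after `s` is `ek`. -/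
lemma MarkovFrom.exists_firstEventSet (hM : IsMarkovCountingSystem P X N)
    (hK : MarkovFrom X N K μ t) [IsFiniteMeasure μ] {s : ℝ≥0} (hs : t ≤ s) {y : Fin C → ℤ}
    {q : Transition C → ℕ+ → ℝ≥0} {l : ℝ≥0} (hR : IsRegularState (fun h => K h y) q l) {a : ℝ≥0}
    (ha : 0 < a) (ek : Transition C × ℕ+) :
    ∃ B, MeasurableSet B ∧ B ⊆ firstEventSet N s a ek ∧
      ∀ A, MeasurableSet[history X N s] A →
        μ (A ∩ X s ⁻¹' {y}) * (a * q ek.1 ek.2) ≤ μ (A ∩ X s ⁻¹' {y} ∩ B) * (1 + a * l) := by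
  have hG : ∀ n, MeasurableSet (firstGridSet N s a ek n) := fun n =>
    Finset.measurableSet_biUnion _ fun i _ => measurableSet_firstCellSet hM _ _ _ _
  set U : ℕ → Set Ω := fun m => ⋃ n ∈ Set.Ici m, firstGridSet N s a ek n with hU
  have hUm : ∀ m, MeasurableSet (U m) := fun m =>
    MeasurableSet.biUnion (Set.to_countable _) fun n _ => hG n
  have hUanti : Antitone U := fun m m' hmm' =>
    Set.biUnion_subset_biUnion_left (Set.Ici_subset_Ici.2 hmm')
  -- The limsup of the grid sets is a measurable part of `firstEventSet`, chosen independently of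
  -- `A`. The tails `U m` decrease to it, so it inherits the lower bounds for the measures of the
  -- grid sets.
  refine ⟨⋂ m, U m, MeasurableSet.iInter hUm, fun ω hω => ?_, fun A hA => ?_⟩
  · refine mem_firstEventSet_of_frequently hM ha (frequently_atTop.2 fun m => ?_)
    have := Set.mem_iInter.1 hω m
    simpa [hU] using this
  have hAm : MeasurableSet (A ∩ X s ⁻¹' {y}) :=
    (hM.history_le s _ hA).inter (hM.measurable_state s (measurableSet_singleton y))
  have hlim : Tendsto (fun m => μ (A ∩ X s ⁻¹' {y} ∩ U m)) atTop
      (𝓝 (μ (A ∩ X s ⁻¹' {y} ∩ ⋂ m, U m))) := by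
    rw [Set.inter_iInter]
    exact tendsto_measure_iInter_atTop (fun m => (hAm.inter (hUm m)).nullMeasurableSet)
      (fun m m' h => Set.inter_subset_inter_right _ (hUanti h)) ⟨0, measure_ne_top _ _⟩
  refine le_of_tendsto_of_tendsto
    (ENNReal.Tendsto.const_mul (tendsto_mul_mesh ha (hR.single ek)) (Or.inr (measure_ne_top _ _)))
    (ENNReal.Tendsto.mul hlim (Or.inr ?_)
      (tendsto_const_nhds.add (tendsto_mul_mesh ha hR.event)) (Or.inr (measure_ne_top _ _)))
    (Eventually.of_forall fun n => ?_)
  · exact ENNReal.add_ne_top.2 ⟨ENNReal.one_ne_top,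
      ENNReal.mul_ne_top ENNReal.coe_ne_top ENNReal.coe_ne_top⟩
  simp only
  set d := a / ((n + 1 : ℕ) : ℝ≥0) with hd
  have hsum : μ (A ∩ X s ⁻¹' {y} ∩ firstGridSet N s a ek n)
      = μ (A ∩ X s ⁻¹' {y}) * (∑ i ∈ Finset.range (n + 1), K d y {0} ^ i)
        * K d y {singleEvent ek} := by
    rw [firstGridSet, Set.inter_iUnion₂, measure_biUnion_finset]
    · rw [Finset.mul_sum, Finset.sum_mul]
      refine Finset.sum_congr rfl fun i _ => ?_
      rw [firstCellSet, ← Set.inter_assoc]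
      exact (hK.no_event_grid hM hs d y hA i).2 _
    · intro i _ j _ hij
      exact (disjoint_firstCellSet hM s d ek hij).mono Set.inter_subset_right
        Set.inter_subset_right
    · exact fun i _ => hAm.inter (measurableSet_firstCellSet hM _ _ _ _)
  have hru : K d y {0} + K d y {0}ᶜ = 1 := by
    rw [measure_add_measure_compl (measurableSet_singleton _), hR.univ]
  -- The number of cells is traded for the geometric sum of the probabilities that the first
  -- occupied cell is the i-th.
  calc μ (A ∩ X s ⁻¹' {y}) * (((n + 1 : ℕ) : ℝ≥0∞) * K d y {singleEvent ek})
      ≤ μ (A ∩ X s ⁻¹' {y}) * (((∑ i ∈ Finset.range (n + 1), K d y {0} ^ i)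
          * (1 + ((n + 1 : ℕ) : ℝ≥0∞) * K d y {0}ᶜ)) * K d y {singleEvent ek}) := by
        gcongr
        exact nat_le_geom_sum_mul hru (n + 1)
    _ = μ (A ∩ X s ⁻¹' {y} ∩ firstGridSet N s a ek n)
          * (1 + ((n + 1 : ℕ) : ℝ≥0∞) * K d y {0}ᶜ) := by
        rw [hsum]
        ring
    _ ≤ μ (A ∩ X s ⁻¹' {y} ∩ U n) * (1 + ((n + 1 : ℕ) : ℝ≥0∞) * K d y {0}ᶜ) := by
        gcongr
        exact Set.subset_biUnion_of_mem (u := fun n => firstGridSet N s a ek n)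
          (Set.mem_Ici.2 le_rfl)

end Grid
-- Domination of the rate moments by the suprema in P4
section Domination

/-- Suprema over uncountably many times need not be measurable, and `lintegral` is then a lower
integral. A measurable minorant attaining it must absorb every other one, since otherwise their
maximum would have a larger integral. -/
lemma exists_maximal_measurable_minorant {Ω : Type*} [MeasurableSpace Ω] {μ : Measure Ω}
    {f : Ω → ℝ≥0∞} (hf : ∫⁻ ω, f ω ∂μ ≠ ∞) :
    ∃ g, Measurable g ∧ g ≤ f ∧ ∀ h, Measurable h → h ≤ f → h ≤ᵐ[μ] g := by
  obtain ⟨g, hg, hgf, hint⟩ := exists_measurable_le_lintegral_eq μ f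
  refine ⟨g, hg, hgf, fun h hh hhf => ?_⟩
  have h1 : g =ᵐ[μ] fun ω => max (g ω) (h ω) :=
    ae_eq_of_ae_le_of_lintegral_le (Eventually.of_forall fun ω => le_max_left _ _)
      (hint ▸ hf) (hg.max hh).aemeasurable
      (hint ▸ lintegral_mono fun ω => max_le (hgf ω) (hhf ω))
  filter_upwards [h1] with ω hω
  rw [hω]
  exact le_max_right _ _

lemma lintegral_sq_ne_top_of_evariance {Ω : Type*} [MeasurableSpace Ω] {μ : Measure Ω}
    [IsFiniteMeasure μ] {f : Ω → ℝ≥0∞} (hf : ∀ ω, f ω ≠ ∞)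
    (h : evariance (fun ω => (f ω).toReal) μ < ∞) : ∫⁻ ω, f ω ^ 2 ∂μ ≠ ∞ := by
  set c : ℝ := ∫ ω, (f ω).toReal ∂μ with hc
  -- This holds for every real c, so it is harmless that `c` takes the default value 0 when the
  -- function is not integrable.
  have hpt : ∀ ω, f ω ^ 2 ≤ 2 * ‖(f ω).toReal - c‖ₑ ^ 2 + 2 * ENNReal.ofReal (c ^ 2) := by
    intro ω
    have h1 : f ω ^ 2 = ENNReal.ofReal ((f ω).toReal ^ 2) := by
      rw [ENNReal.ofReal_pow ENNReal.toReal_nonneg, ENNReal.ofReal_toReal (hf ω)]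
    have h2 : ‖(f ω).toReal - c‖ₑ ^ 2 = ENNReal.ofReal (((f ω).toReal - c) ^ 2) := by
      rw [← ofReal_norm, ← ENNReal.ofReal_pow (norm_nonneg _), Real.norm_eq_abs, sq_abs]
    have h3 : (2 : ℝ≥0∞) = ENNReal.ofReal 2 := by simp
    rw [h1, h2, h3, ← ENNReal.ofReal_mul (by norm_num), ← ENNReal.ofReal_mul (by norm_num),
      ← ENNReal.ofReal_add (by positivity) (by positivity)]
    refine ENNReal.ofReal_le_ofReal ?_
    nlinarith [sq_nonneg ((f ω).toReal - c - c)]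
  refine ((lintegral_mono hpt).trans_lt ?_).ne
  rw [lintegral_add_right _ measurable_const, lintegral_const_mul' _ _ (by simp), lintegral_const]
  refine ENNReal.add_lt_top.2 ⟨ENNReal.mul_lt_top (by simp) h, ?_⟩
  exact ENNReal.mul_lt_top (ENNReal.mul_lt_top (by simp) ENNReal.ofReal_lt_top) (measure_lt_top _ _)

/-- The quotient (1 + aM)/(aM^(j+1)) decreases in M, so it is at most its value at M = l. This makes
the domination constant independent of the state. -/
lemma one_add_mul_le {a l M : ℝ≥0} (ha : 0 < a) (hl : 0 < l) (hM : l ≤ M) (j : ℕ) :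
    1 + a * M ≤ ((a * l ^ (j + 1))⁻¹ + (l ^ j)⁻¹) * (a * M ^ (j + 1)) := by
  have h1 : (1 : ℝ≥0) ≤ (M / l) := (one_le_div hl).2 hM
  have h2 : ((a * l ^ (j + 1))⁻¹ + (l ^ j)⁻¹) * (a * M ^ (j + 1))
      = (M / l) ^ (j + 1) + a * M * (M / l) ^ j := by
    rw [div_pow, div_pow]
    field_simp
    ring
  rw [h2]
  refine add_le_add (one_le_pow₀ h1) ?_
  calc a * M = a * M * 1 := (mul_one _).symm
    _ ≤ _ := by gcongr; exact one_le_pow₀ h1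

variable {C : ℕ} {Ω : Type*} [MeasurableSpace Ω] {X : ℝ≥0 → Ω → (Fin C → ℤ)}
  {N : Transition C → ℝ≥0 → Ω → ℕ} {P : Measure Ω}
  {K : ℝ≥0 → (Fin C → ℤ) → Measure (Transition C → ℕ)} {μ : Measure Ω} {t : ℝ≥0}

/-- The `p`-th moment of the infinitesimal probabilities of the events of type `e`. -/
noncomputable def rateMoment (q : Transition C → ℕ+ → ℝ≥0) (e : Transition C) (p : ℕ) : ℝ≥0∞ :=
  ∑' k : ℕ+, (k : ℝ≥0∞) ^ p * q e k

lemma le_supJump_of_mem_firstEventSet (hM : IsMarkovCountingSystem P X N) {s a b : ℝ≥0}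
    (hts : t ≤ s) (hab : s + a ≤ t + b) {e : Transition C} {k : ℕ+} {ω : Ω}
    (h : ω ∈ firstEventSet N s a (e, k)) : ((k : ℕ) : ℝ≥0∞) ≤ supJump (N e) t b ω := by
  obtain ⟨τ, hτ, hconst, hτe⟩ := h
  have hj := hM.jump_of_const hτ.1 hconst e
  rw [hτe e, singleEvent, Pi.single_eq_same, Nat.add_sub_cancel_left] at hj
  rw [← hj]
  exact le_iSup₂_of_le (f := fun s (_ : s ∈ Set.Icc t (t + b)) => (jump (N e) s ω : ℝ≥0∞)) τ
    ⟨hts.trans hτ.1.le, hτ.2.trans hab⟩ le_rfl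

lemma disjoint_firstEventSet (s a : ℝ≥0) (e : Transition C) :
    Pairwise (Function.onFun Disjoint fun k : ℕ+ => firstEventSet N s a (e, k)) := by
  intro k k' hkk'
  refine Set.disjoint_left.2 ?_
  rintro ω ⟨τ, hτ, hc, he⟩ ⟨τ', hτ', hc', he'⟩
  have aux : ∀ {τ τ' : ℝ≥0} {k : ℕ+}, s < τ → τ < τ' →
      (∀ u, s ≤ u → u < τ' → ∀ e, N e u ω = N e s ω) →
      (∀ e', N e' τ ω = N e' s ω + singleEvent (e, k) e') → False := by
    intro τ τ' k h1 h2 h3 h4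
    have h5 := h4 e
    rw [h3 τ h1.le h2 e, singleEvent, Pi.single_eq_same] at h5
    have h6 : N e s ω = N e s ω + (k : ℕ) := h5
    have := k.pos
    omega
  rcases lt_trichotomy τ τ' with h | h | h
  · exact aux hτ.1 h hc' he
  · subst h
    have h1 := (he e).symm.trans (he' e)
    simp only [singleEvent, Pi.single_eq_same, add_right_inj] at h1
    exact hkk' (PNat.eq h1)
  · exact aux hτ'.1 h hc he'

/-- Domination, in mean, of a function `Q` of the state by a random variable `G`, uniformly over
the times in `[t, t + a]`. -/
def DominatesAt (X : ℝ≥0 → Ω → (Fin C → ℤ)) (N : Transition C → ℝ≥0 → Ω → ℕ) (μ : Measure Ω)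
    (t a : ℝ≥0) (Q : (Fin C → ℤ) → ℝ≥0∞) (G : Ω → ℝ≥0∞) (c : ℝ≥0) : Prop :=
  ∀ (s : ℝ≥0) (y : Fin C → ℤ) (w : Ω → ℝ≥0∞), t ≤ s → s ≤ t + a →
    Measurable[history X N s] w →
      Q y * ∫⁻ ω in X s ⁻¹' {y}, w ω ∂μ ≤ c * ∫⁻ ω in X s ⁻¹' {y}, w ω * G ω ∂μ

lemma dominatesAt_of_measure_le (hM : IsMarkovCountingSystem P X N) {a : ℝ≥0}
    {Q : (Fin C → ℤ) → ℝ≥0∞} {G : Ω → ℝ≥0∞} (hG : Measurable G) {c : ℝ≥0}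
    (h : ∀ (s : ℝ≥0) (y : Fin C → ℤ) (A : Set Ω), t ≤ s → s ≤ t + a →
      MeasurableSet[history X N s] A →
        Q y * μ (A ∩ X s ⁻¹' {y}) ≤ c * ∫⁻ ω in A ∩ X s ⁻¹' {y}, G ω ∂μ) :
    DominatesAt X N μ t a Q G c := by
  intro s y w hts hsa hw
  have hle := hM.history_le s
  have htrim : (Q y • μ.restrict (X s ⁻¹' {y})).trim hle
      ≤ ((c : ℝ≥0∞) • (μ.restrict (X s ⁻¹' {y})).withDensity G).trim hle := by
    refine (@Measure.le_iff _ (history X N s) _ _).2 fun A hA => ?_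
    rw [trim_measurableSet_eq hle hA, trim_measurableSet_eq hle hA, Measure.smul_apply,
      Measure.smul_apply, withDensity_apply _ (hle _ hA), Measure.restrict_restrict (hle _ hA),
      Measure.restrict_apply (hle _ hA), smul_eq_mul, smul_eq_mul]
    exact h s y A hts hsa hA
  have h1 := lintegral_mono' (f := w) htrim le_rfl
  rw [lintegral_trim hle hw, lintegral_trim hle hw, lintegral_smul_measure,
    lintegral_smul_measure, lintegral_withDensity_eq_lintegral_mul _ hG (hw.mono hle le_rfl),
    smul_eq_mul, smul_eq_mul] at h1
  simpa only [Pi.mul_apply, mul_comm] using h1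

/-- If the first event after s is a k-fold one of type `e` within time a, the product of the suprema
over [t, t + 2a] is at least k·M, with M = max(λ(x), λ(y)); the doubled window leaves room for that
event even when s = t + a. These events are disjoint in k, and each has conditional probability at
least a q(y,k)/(1 + aλ(y)). Summing (kM)^(j+1) over k bounds the moment at y. -/
lemma MarkovFrom.exists_dominatesAt (hM : IsMarkovCountingSystem P X N)
    (hK : MarkovFrom X N K μ t) [IsFiniteMeasure μ]
    {q : Transition C → (Fin C → ℤ) → ℕ+ → ℝ≥0} {lam : (Fin C → ℤ) → ℝ≥0}
    (hR : ∀ s y, μ (X s ⁻¹' {y}) ≠ 0 → IsRegularState (fun h => K h y) (fun e => q e y) (lam y))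
    {x : Fin C → ℤ} (hx : ∀ᵐ ω ∂μ, X t ω = x) (hl : 0 < lam x) {a : ℝ≥0} (ha : 0 < a)
    (e : Transition C)
    (hv : ∫⁻ ω, (supJump (N e) t (a + a) ω * supRate X lam t (a + a) ω) ^ 2 ∂μ ≠ ∞) :
    ∃ g : Ω → ℝ≥0∞, Measurable g ∧ ∫⁻ ω, g ω ^ 2 ∂μ ≠ ∞ ∧ ∀ j : ℕ, ∃ c : ℝ≥0,
      DominatesAt X N μ t a (fun y => rateMoment (fun e => q e y) e (j + 1))
        (fun ω => g ω ^ (j + 1)) c := by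
  set f : Ω → ℝ≥0∞ := fun ω => supJump (N e) t (a + a) ω * supRate X lam t (a + a) ω with hf
  have hf1 : ∫⁻ ω, f ω ∂μ ≠ ∞ := by
    have hpt : ∀ ω, f ω ≤ f ω ^ 2 + 1 := fun ω => by
      rcases le_total (f ω) 1 with h | h
      · exact le_add_left h
      · exact le_add_right (le_self_pow₀ h (by norm_num))
    refine ((lintegral_mono hpt).trans_lt ?_).ne
    rw [lintegral_add_right _ measurable_const, lintegral_const, one_mul]
    exact ENNReal.add_lt_top.2 ⟨hv.lt_top, measure_lt_top _ _⟩
  obtain ⟨g, hg, hgf, hmax⟩ := exists_maximal_measurable_minorant hf1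
  refine ⟨g, hg, ((lintegral_mono fun ω => pow_le_pow_left' (hgf ω) 2).trans_lt hv.lt_top).ne,
    fun j => ⟨(a * lam x ^ (j + 1))⁻¹ + (lam x ^ j)⁻¹, ?_⟩⟩
  refine dominatesAt_of_measure_le hM (hg.pow_const _) fun s y A hts hsa hA => ?_
  have hSm : MeasurableSet (X s ⁻¹' {y}) := hM.measurable_state s (measurableSet_singleton y)
  by_cases hy : μ (X s ⁻¹' {y}) = 0
  · rw [measure_mono_null Set.inter_subset_right hy, mul_zero]
    exact zero_le
  have hRy := hR s y hy
  choose B hBm hBsub hB using fun k : ℕ+ => hK.exists_firstEventSet hM hts hRy ha (e, k)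
  -- Including the rate at the initial state keeps M away from 0, even when `y` has a small rate.
  set M : ℝ≥0 := max (lam x) (lam y) with hMdef
  have hAm : MeasurableSet (A ∩ X s ⁻¹' {y}) := (hM.history_le s _ hA).inter hSm
  have hbound : ∀ᵐ ω ∂μ, ∀ k : ℕ+, ω ∈ A ∩ X s ⁻¹' {y} ∩ B k →
      ((k : ℝ≥0∞) * M) ^ (j + 1) ≤ g ω ^ (j + 1) := by
    have hxm : MeasurableSet (X t ⁻¹' {x}) := hM.measurable_state t (measurableSet_singleton x)
    have h1 : ∀ᵐ ω ∂μ, ∀ k : ℕ+, (X t ⁻¹' {x} ∩ X s ⁻¹' {y} ∩ B k).indicator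
        (fun _ => (k : ℝ≥0∞) * M) ω ≤ g ω := by
      refine ae_all_iff.2 fun k => hmax _ (measurable_const.indicator
        ((hxm.inter hSm).inter (hBm k))) fun ω => Set.indicator_le (fun ω hω => ?_) ω
      refine mul_le_mul' (le_supJump_of_mem_firstEventSet hM hts ?_ (hBsub k hω.2)) ?_
      · rw [← add_assoc]
        gcongr
      · have hle : ∀ u ∈ Set.Icc t (t + (a + a)),
            (lam (X u ω) : ℝ≥0∞) ≤ supRate X lam t (a + a) ω := fun u hu =>
          le_iSup₂_of_le (f := fun s (_ : s ∈ Set.Icc t (t + (a + a))) =>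
            (lam (X s ω) : ℝ≥0∞)) u hu le_rfl
        have h2 := hle t ⟨le_rfl, le_self_add⟩
        have h3 := hle s ⟨hts, hsa.trans (by gcongr; exact le_self_add)⟩
        rw [show X t ω = x from hω.1.1] at h2
        rw [show X s ω = y from hω.1.2] at h3
        rw [hMdef, ENNReal.coe_max]
        exact max_le h2 h3
    filter_upwards [h1, hx] with ω hω hxω k hk
    have := hω k
    have hmem : ω ∈ X t ⁻¹' {x} ∩ X s ⁻¹' {y} ∩ B k := ⟨⟨hxω, hk.1.2⟩, hk.2⟩
    rw [Set.indicator_of_mem hmem] at this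
    gcongr
  have hdisj : Pairwise (Function.onFun Disjoint fun k : ℕ+ => A ∩ X s ⁻¹' {y} ∩ B k) :=
    fun k k' hkk' => (disjoint_firstEventSet s a e hkk').mono
      (Set.inter_subset_right.trans (hBsub k)) (Set.inter_subset_right.trans (hBsub k'))
  have hint : ∑' k : ℕ+, ((k : ℝ≥0∞) * M) ^ (j + 1) * μ (A ∩ X s ⁻¹' {y} ∩ B k)
      ≤ ∫⁻ ω in A ∩ X s ⁻¹' {y}, g ω ^ (j + 1) ∂μ := by
    refine le_trans ?_ (lintegral_mono_set
      (Set.iUnion_subset fun k => (Set.inter_subset_left (t := B k))))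
    rw [lintegral_iUnion (fun k => hAm.inter (hBm k)) hdisj]
    refine ENNReal.tsum_le_tsum fun k => ?_
    rw [← setLIntegral_const]
    refine setLIntegral_mono_ae (hg.pow_const _).aemeasurable ?_
    filter_upwards [hbound] with ω hω using hω k
  have hkey : rateMoment (fun e => q e y) e (j + 1) * μ (A ∩ X s ⁻¹' {y}) * (a * M ^ (j + 1))
      ≤ (∫⁻ ω in A ∩ X s ⁻¹' {y}, g ω ^ (j + 1) ∂μ) * (1 + a * lam y) := by
    refine le_trans ?_ (mul_le_mul_left hint _)
    rw [rateMoment, ← ENNReal.tsum_mul_right, ← ENNReal.tsum_mul_right, ← ENNReal.tsum_mul_right]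
    refine ENNReal.tsum_le_tsum fun k => ?_
    have := hB k A hA
    calc (k : ℝ≥0∞) ^ (j + 1) * q e y k * μ (A ∩ X s ⁻¹' {y}) * (a * M ^ (j + 1))
        = ((k : ℝ≥0∞) * M) ^ (j + 1) * (μ (A ∩ X s ⁻¹' {y}) * (a * q e y k)) := by
          rw [mul_pow]; ring
      _ ≤ ((k : ℝ≥0∞) * M) ^ (j + 1) * (μ (A ∩ X s ⁻¹' {y} ∩ B k) * (1 + a * lam y)) := by
          gcongr
      _ = _ := by ring
  have hMpos : 0 < M := hl.trans_le (le_max_left _ _)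
  have hc : (1 + a * lam y : ℝ≥0∞)
      ≤ (((a * lam x ^ (j + 1))⁻¹ + (lam x ^ j)⁻¹ : ℝ≥0) : ℝ≥0∞) * (a * M ^ (j + 1)) := by
    have h1 : 1 + a * lam y ≤ 1 + a * M := by gcongr; exact le_max_right _ _
    exact_mod_cast h1.trans (one_add_mul_le ha hl (le_max_left _ _) j)
  have hne : (a * M ^ (j + 1) : ℝ≥0∞) ≠ 0 := by
    have : a * M ^ (j + 1) ≠ 0 := by positivity
    exact_mod_cast this
  have hnt : (a * M ^ (j + 1) : ℝ≥0∞) ≠ ∞ := by exact_mod_cast ENNReal.coe_ne_top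
  refine (ENNReal.mul_le_mul_iff_left hne hnt).1 (hkey.trans ?_)
  calc _ ≤ (∫⁻ ω in A ∩ X s ⁻¹' {y}, g ω ^ (j + 1) ∂μ)
        * ((((a * lam x ^ (j + 1))⁻¹ + (lam x ^ j)⁻¹ : ℝ≥0) : ℝ≥0∞) * (a * M ^ (j + 1))) := by
        gcongr
    _ = _ := by ring

end Domination
-- Upper bound for the second moment of truncated increments
section SecondMoment

lemma ENNReal.two_mul_mul_le_add_sq (a b : ℝ≥0∞) : 2 * (a * b) ≤ a ^ 2 + b ^ 2 := by
  by_cases ha : a = ∞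
  · simp [ha]
  by_cases hb : b = ∞
  · simp [hb]
  lift a to ℝ≥0 using ha
  lift b to ℝ≥0 using hb
  have := two_mul_le_add_sq a b
  rw [mul_assoc] at this
  exact_mod_cast this

variable {C : ℕ} {Ω : Type*} [MeasurableSpace Ω] {X : ℝ≥0 → Ω → (Fin C → ℤ)}
  {N : Transition C → ℝ≥0 → Ω → ℕ} {P : Measure Ω}
  {K : ℝ≥0 → (Fin C → ℤ) → Measure (Transition C → ℕ)} {μ : Measure Ω} {t : ℝ≥0}

/-- The increment of a counting process over `[s, s + h]`, truncated at `L`. -/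
def truncIncr (N : ℝ≥0 → Ω → ℕ) (s h : ℝ≥0) (L : ℕ) (ω : Ω) : ℝ≥0∞ :=
  (min (increment N s h ω) L : ℕ)

lemma truncIncr_le (N : ℝ≥0 → Ω → ℕ) (s h : ℝ≥0) (L : ℕ) (ω : Ω) : truncIncr N s h L ω ≤ L := by
  exact Nat.cast_le.2 (min_le_right _ _)

lemma measurable_truncIncr {s u v : ℝ≥0} (h : u + v ≤ s) (e : Transition C) (L : ℕ) :
    Measurable[history X N s] (truncIncr (N e) u v L) :=
  (Measurable.of_discrete (f := fun n : ℕ => ((min n L : ℕ) : ℝ≥0∞))).comp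
    (measurable_history_increment h e)

lemma truncIncr_mono (hM : IsMarkovCountingSystem P X N) (e : Transition C) (s : ℝ≥0) {u v : ℝ≥0}
    (h : u ≤ v) (L : ℕ) (ω : Ω) : truncIncr (N e) s u L ω ≤ truncIncr (N e) s v L ω := by
  have : N e (s + u) ω ≤ N e (s + v) ω := hM.count_mono e ω (by gcongr)
  refine Nat.cast_le.2 (min_le_min_right _ ?_)
  exact Nat.sub_le_sub_right this _

/-- Truncation is subadditive, so the square grows over one more cell by at most δ² + 2Yδ. In the
cross term Y belongs to the history at the start of the cell, so the Markov property factors it. -/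
lemma truncIncr_sq_le_sum (hM : IsMarkovCountingSystem P X N) (e : Transition C) (d : ℝ≥0) (L m : ℕ)
    (ω : Ω) :
    truncIncr (N e) t (m * d) L ω ^ 2 ≤ ∑ i ∈ Finset.range m,
      (truncIncr (N e) (t + i * d) d L ω ^ 2
        + 2 * (truncIncr (N e) t (i * d) L ω * truncIncr (N e) (t + i * d) d L ω)) := by
  induction m with
  | zero => simp [truncIncr, increment]
  | succ m ih =>
    rw [Finset.sum_range_succ]
    refine le_trans ?_ (add_le_add_left ih _)
    have h1 : truncIncr (N e) t ((m + 1 : ℕ) * d) L ω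
        ≤ truncIncr (N e) t (m * d) L ω + truncIncr (N e) (t + m * d) d L ω := by
      rw [Nat.cast_succ, add_mul, one_mul]
      simp only [truncIncr, hM.increment_add e t (m * d) d ω]
      rw [← Nat.cast_add]
      exact Nat.cast_le.2 (by omega)
    calc _ ≤ (truncIncr (N e) t (m * d) L ω + truncIncr (N e) (t + m * d) d L ω) ^ 2 := by
          gcongr
      _ = _ := by ring

lemma sum_setLIntegral_fiber (hM : IsMarkovCountingSystem P X N) (s : ℝ≥0)
    (F : Finset (Fin C → ℤ)) (f : Ω → ℝ≥0∞) :
    ∑ y ∈ F, ∫⁻ ω in X s ⁻¹' {y}, f ω ∂μ = ∫⁻ ω in X s ⁻¹' F, f ω ∂μ := by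
  rw [← lintegral_biUnion_finset]
  · congr 2
    ext ω
    simp
  · intro y _ y' _ hyy'
    refine Set.disjoint_left.2 fun ω h h' => hyy' ?_
    exact h.symm.trans h'
  · exact fun y _ => hM.measurable_state s (measurableSet_singleton y)

/-- The contribution of one cell of the grid to the second moment of the truncated increment. -/
lemma MarkovFrom.lintegral_cell_le (hM : IsMarkovCountingSystem P X N) (hK : MarkovFrom X N K μ t)
    [IsProbabilityMeasure μ] {q : Transition C → (Fin C → ℤ) → ℕ+ → ℝ≥0}
    {x : Fin C → ℤ} (hx : ∀ᵐ ω ∂μ, X t ω = x) {a : ℝ≥0} {e : Transition C} {g : Ω → ℝ≥0∞}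
    {c₁ c₂ : ℝ≥0}
    (hD₁ : DominatesAt X N μ t a (fun y => rateMoment (fun e => q e y) e 1) g c₁)
    (hD₂ : DominatesAt X N μ t a (fun y => rateMoment (fun e => q e y) e 2) (fun ω => g ω ^ 2) c₂)
    {h : ℝ≥0} (ha : h ≤ a) (L : ℕ) {u d : ℝ≥0} (hu : u ≤ h) (F : Finset (Fin C → ℤ)) {ε : ℝ≥0∞}
    (hF : ∀ y ∈ F, μ (X (t + u) ⁻¹' {y}) ≠ 0 →
      ∫⁻ n, ((min (n e) L : ℕ) : ℝ≥0∞) ^ 2 ∂K d y ≤ d * (rateMoment (fun e => q e y) e 2 + ε) ∧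
      ∫⁻ n, ((min (n e) L : ℕ) : ℝ≥0∞) ∂K d y ≤ d * (rateMoment (fun e => q e y) e 1 + ε)) :
    ∫⁻ ω in X (t + u) ⁻¹' F, (truncIncr (N e) (t + u) d L ω ^ 2
        + 2 * (truncIncr (N e) t u L ω * truncIncr (N e) (t + u) d L ω)) ∂μ
      ≤ d * (rateMoment (fun e => q e x) e 2
        + c₂ * ∫⁻ ω in {ω | incr N t h ω ≠ 0}, g ω ^ 2 ∂μ
        + 2 * (c₁ * ∫⁻ ω, truncIncr (N e) t h L ω * g ω ∂μ) + ε * (1 + 2 * L)) := by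
  set s := t + u with hs
  have hts : t ≤ s := le_self_add
  have hsa : s ≤ t + a := by rw [hs]; gcongr; exact hu.trans ha
  set m₁ : (Fin C → ℤ) → ℝ≥0∞ := fun y => rateMoment (fun e => q e y) e 1 with hm₁
  set m₂ : (Fin C → ℤ) → ℝ≥0∞ := fun y => rateMoment (fun e => q e y) e 2 with hm₂
  set Y : Ω → ℝ≥0∞ := truncIncr (N e) t u L with hY
  have hYm : Measurable[history X N s] Y := measurable_truncIncr le_rfl e L
  have hY' : Measurable Y := hYm.mono (hM.history_le s) le_rfl
  have hDm : Measurable (truncIncr (N e) s d L) :=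
    (measurable_truncIncr (X := X) le_rfl e L).mono (hM.history_le _) le_rfl
  have hcell : ∀ y ∈ F, ∫⁻ ω in X s ⁻¹' {y}, (truncIncr (N e) s d L ω ^ 2
        + 2 * (Y ω * truncIncr (N e) s d L ω)) ∂μ
      ≤ d * (m₂ y * μ (X s ⁻¹' {y}) + 2 * (m₁ y * ∫⁻ ω in X s ⁻¹' {y}, Y ω ∂μ)
        + ε * ((1 + 2 * L) * μ (X s ⁻¹' {y}))) := by
    intro y hy
    by_cases h0 : μ (X s ⁻¹' {y}) = 0
    · rw [Measure.restrict_eq_zero.2 h0, lintegral_zero_measure]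
      exact zero_le
    obtain ⟨h2, h1⟩ := hF y hy h0
    rw [lintegral_add_left (hDm.pow_const _), 
      lintegral_const_mul (f := fun ω => Y ω * truncIncr (N e) s d L ω) _ (hY'.mul hDm)]
    have e2 := hK.lintegral hM hts d y (w := fun _ => 1) measurable_const
      (fun n => ((min (n e) L : ℕ) : ℝ≥0∞) ^ 2)
    have e1 := hK.lintegral hM hts d y hYm (fun n => ((min (n e) L : ℕ) : ℝ≥0∞))
    simp only [one_mul, setLIntegral_const] at e2
    have hYL : ∫⁻ ω in X s ⁻¹' {y}, Y ω ∂μ ≤ L * μ (X s ⁻¹' {y}) := by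
      rw [← setLIntegral_const]
      exact lintegral_mono fun ω => truncIncr_le _ _ _ _ _
    calc _ = μ (X s ⁻¹' {y}) * ∫⁻ n, ((min (n e) L : ℕ) : ℝ≥0∞) ^ 2 ∂K d y
          + 2 * ((∫⁻ ω in X s ⁻¹' {y}, Y ω ∂μ) * ∫⁻ n, ((min (n e) L : ℕ) : ℝ≥0∞) ∂K d y) := by
          rw [← e1, ← e2]
          rfl
      _ ≤ μ (X s ⁻¹' {y}) * (d * (m₂ y + ε))
          + 2 * ((∫⁻ ω in X s ⁻¹' {y}, Y ω ∂μ) * (d * (m₁ y + ε))) := by gcongr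
      _ = d * (m₂ y * μ (X s ⁻¹' {y}) + 2 * (m₁ y * ∫⁻ ω in X s ⁻¹' {y}, Y ω ∂μ)
        + ε * (μ (X s ⁻¹' {y}) + 2 * ∫⁻ ω in X s ⁻¹' {y}, Y ω ∂μ)) := by ring
      _ ≤ d * (m₂ y * μ (X s ⁻¹' {y}) + 2 * (m₁ y * ∫⁻ ω in X s ⁻¹' {y}, Y ω ∂μ)
        + ε * (μ (X s ⁻¹' {y}) + 2 * (L * μ (X s ⁻¹' {y})))) := by gcongr
      _ = _ := by ring
  have hmass : ∑ y ∈ F, μ (X s ⁻¹' {y}) ≤ 1 := by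
    have := sum_setLIntegral_fiber (μ := μ) hM s F (fun _ => 1)
    simp only [setLIntegral_const, one_mul] at this
    rw [this]
    exact prob_le_one
  have hfirst : ∑ y ∈ F, m₁ y * ∫⁻ ω in X s ⁻¹' {y}, Y ω ∂μ
      ≤ c₁ * ∫⁻ ω, truncIncr (N e) t h L ω * g ω ∂μ := by
    calc _ ≤ ∑ y ∈ F, c₁ * ∫⁻ ω in X s ⁻¹' {y}, Y ω * g ω ∂μ :=
          Finset.sum_le_sum fun y _ => hD₁ s y Y hts hsa hYm
      _ = c₁ * ∫⁻ ω in X s ⁻¹' F, Y ω * g ω ∂μ := by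
          rw [← Finset.mul_sum, sum_setLIntegral_fiber hM]
      _ ≤ c₁ * ∫⁻ ω, Y ω * g ω ∂μ := mul_le_mul' le_rfl (setLIntegral_le_lintegral _ _)
      _ ≤ _ := by
          gcongr with ω
          exact truncIncr_mono hM e t hu L ω
  -- The state `x` is split off with mass at most 1, whether or not it lies in `F`. Any other state
  -- can be occupied only after an event in [t, t + h], which restricts the integral of g².
  have hsecond : ∑ y ∈ F, m₂ y * μ (X s ⁻¹' {y})
      ≤ m₂ x + c₂ * ∫⁻ ω in {ω | incr N t h ω ≠ 0}, g ω ^ 2 ∂μ := by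
    classical
    calc ∑ y ∈ F, m₂ y * μ (X s ⁻¹' {y})
        ≤ ∑ y ∈ insert x (F.erase x), m₂ y * μ (X s ⁻¹' {y}) :=
          Finset.sum_le_sum_of_subset (Finset.insert_erase_subset x F)
      _ = m₂ x * μ (X s ⁻¹' {x}) + ∑ y ∈ F.erase x, m₂ y * μ (X s ⁻¹' {y}) :=
          Finset.sum_insert (Finset.notMem_erase x F)
      _ ≤ m₂ x * 1 + ∑ y ∈ F.erase x, c₂ * ∫⁻ ω in X s ⁻¹' {y}, g ω ^ 2 ∂μ := by
          refine add_le_add (mul_le_mul' le_rfl prob_le_one) (Finset.sum_le_sum fun y _ => ?_)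
          simpa using hD₂ s y (fun _ => 1) hts hsa measurable_const
      _ = m₂ x + c₂ * ∫⁻ ω in X s ⁻¹' (F.erase x : Finset _), g ω ^ 2 ∂μ := by
          rw [mul_one, ← Finset.mul_sum, sum_setLIntegral_fiber hM]
      _ ≤ _ := by
          refine add_le_add le_rfl (mul_le_mul' le_rfl ?_)
          refine lintegral_mono' (Measure.restrict_mono' ?_ le_rfl) le_rfl
          filter_upwards [hx] with ω hxω hω h0
          have hmem : X s ω ∈ F.erase x := hω
          refine Finset.ne_of_mem_erase hmem ?_
          rw [← hxω]
          exact hM.state_congr fun e => hM.count_le_of_incr h0 hts (by rw [hs]; gcongr) e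
  calc _ = ∑ y ∈ F, ∫⁻ ω in X s ⁻¹' {y}, (truncIncr (N e) s d L ω ^ 2
        + 2 * (Y ω * truncIncr (N e) s d L ω)) ∂μ := (sum_setLIntegral_fiber hM s F _).symm
    _ ≤ ∑ y ∈ F, d * (m₂ y * μ (X s ⁻¹' {y}) + 2 * (m₁ y * ∫⁻ ω in X s ⁻¹' {y}, Y ω ∂μ)
        + ε * ((1 + 2 * L) * μ (X s ⁻¹' {y}))) := Finset.sum_le_sum hcell
    _ = d * (∑ y ∈ F, m₂ y * μ (X s ⁻¹' {y})
        + 2 * ∑ y ∈ F, m₁ y * ∫⁻ ω in X s ⁻¹' {y}, Y ω ∂μ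
        + ε * ((1 + 2 * L) * ∑ y ∈ F, μ (X s ⁻¹' {y}))) := by
        simp only [Finset.mul_sum, Finset.sum_add_distrib, mul_add]
    _ ≤ _ := by
        gcongr
        calc _ ≤ (1 + 2 * (L : ℝ≥0∞)) * 1 := by gcongr
          _ = _ := mul_one _

lemma IsRegularState.eventually_trunc_le {K : ℝ≥0 → Measure (Transition C → ℕ)}
    {q : Transition C → ℕ+ → ℝ≥0} {l : ℝ≥0} (hR : IsRegularState K q l) (e : Transition C) (L : ℕ)
    (j : ℕ) {ε : ℝ≥0∞} (hε : 0 < ε) :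
    ∀ᶠ h : ℝ≥0 in 𝓝[>] 0, ∫⁻ n, ((min (n e) L : ℕ) : ℝ≥0∞) ^ (j + 1) ∂K h
      ≤ h * (rateMoment q e (j + 1) + ε) := by
  have := hR.eventually_lintegral_le (φ := fun n => ((min n L : ℕ) : ℝ≥0) ^ (j + 1))
    (B := (L : ℝ≥0) ^ (j + 1)) (by simp)
    (fun n => by gcongr; exact min_le_right _ _) e hε
  filter_upwards [this] with h hh
  simp only [ENNReal.coe_pow, ENNReal.coe_natCast] at hh
  refine hh.trans ?_
  gcongr
  refine ENNReal.tsum_le_tsum fun k => ?_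
  gcongr
  exact min_le_left _ _

/-- The cell bounds add up to length h. Truncation keeps their error terms at ε(1 + 2L), which
disappear with ε before L is released. -/
lemma MarkovFrom.lintegral_truncIncr_sq_le (hM : IsMarkovCountingSystem P X N)
    (hK : MarkovFrom X N K μ t) [IsProbabilityMeasure μ]
    {q : Transition C → (Fin C → ℤ) → ℕ+ → ℝ≥0} {lam : (Fin C → ℤ) → ℝ≥0}
    (hR : ∀ s y, μ (X s ⁻¹' {y}) ≠ 0 → IsRegularState (fun h => K h y) (fun e => q e y) (lam y))
    {x : Fin C → ℤ} (hx : ∀ᵐ ω ∂μ, X t ω = x) {a : ℝ≥0} {e : Transition C} {g : Ω → ℝ≥0∞}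
    {c₁ c₂ : ℝ≥0}
    (hD₁ : DominatesAt X N μ t a (fun y => rateMoment (fun e => q e y) e 1) g c₁)
    (hD₂ : DominatesAt X N μ t a (fun y => rateMoment (fun e => q e y) e 2) (fun ω => g ω ^ 2) c₂)
    {h : ℝ≥0} (hpos : 0 < h) (ha : h ≤ a) (L : ℕ) :
    ∫⁻ ω, truncIncr (N e) t h L ω ^ 2 ∂μ
      ≤ h * (rateMoment (fun e => q e x) e 2
        + c₂ * ∫⁻ ω in {ω | incr N t h ω ≠ 0}, g ω ^ 2 ∂μ
        + 2 * (c₁ * ∫⁻ ω, truncIncr (N e) t h L ω * g ω ∂μ)) := by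
  classical
  set M := rateMoment (fun e => q e x) e 2
        + c₂ * ∫⁻ ω in {ω | incr N t h ω ≠ 0}, g ω ^ 2 ∂μ
        + 2 * (c₁ * ∫⁻ ω, truncIncr (N e) t h L ω * g ω ∂μ) with hMdef
  have hlim : Tendsto (fun ε : ℝ≥0∞ => h * (M + ε * (1 + 2 * L))) (𝓝[>] 0)
      (𝓝 (h * (M + 0 * (1 + 2 * L)))) := by
    refine ENNReal.Tendsto.const_mul (tendsto_const_nhds.add ?_) (Or.inr ENNReal.coe_ne_top)
    refine ENNReal.Tendsto.mul_const (tendsto_id.mono_left nhdsWithin_le_nhds) (Or.inr ?_)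
    finiteness
  rw [zero_mul, add_zero] at hlim
  refine ge_of_tendsto hlim ?_
  filter_upwards [self_mem_nhdsWithin] with ε hε
  have hε : 0 < ε := hε
  -- The short-time estimates are not uniform in the state. They are used on finite sets `F m`
  -- exhausting all states, with the mesh chosen after `F m`. A path visits finitely many states, so
  -- it is eventually covered, and Fatou's lemma passes to the limit in m.
  obtain ⟨enum, henum⟩ := exists_surjective_nat (Fin C → ℤ)
  set F : ℕ → Finset (Fin C → ℤ) := fun m => (Finset.range m).image enum with hFdef
  have hmesh : ∀ m, ∃ n : ℕ, ∀ y ∈ F m, (∃ s, μ (X s ⁻¹' {y}) ≠ 0) →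
      ∫⁻ n', ((min (n' e) L : ℕ) : ℝ≥0∞) ^ 2 ∂K (h / ((n + 1 : ℕ) : ℝ≥0)) y
        ≤ (h / ((n + 1 : ℕ) : ℝ≥0) : ℝ≥0) * (rateMoment (fun e => q e y) e 2 + ε) ∧
      ∫⁻ n', ((min (n' e) L : ℕ) : ℝ≥0∞) ∂K (h / ((n + 1 : ℕ) : ℝ≥0)) y
        ≤ (h / ((n + 1 : ℕ) : ℝ≥0) : ℝ≥0) * (rateMoment (fun e => q e y) e 1 + ε) := by
    intro m
    refine Eventually.exists (f := atTop) ?_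
    refine (Filter.eventually_all_finset _).2 fun y _ => ?_
    by_cases hy : ∃ s, μ (X s ⁻¹' {y}) ≠ 0
    · obtain ⟨s, hs⟩ := hy
      have h2 := (tendsto_mesh hpos).eventually ((hR s y hs).eventually_trunc_le e L 1 hε)
      have h1 := (tendsto_mesh hpos).eventually ((hR s y hs).eventually_trunc_le e L 0 hε)
      filter_upwards [h1, h2] with n hn1 hn2 _
      exact ⟨hn2, by simpa using hn1⟩
    · exact Eventually.of_forall fun n hn => absurd hn hy
  choose n hn using hmesh
  set d : ℕ → ℝ≥0 := fun m => h / ((n m + 1 : ℕ) : ℝ≥0) with hd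
  have hdn : ∀ m, ((n m + 1 : ℕ) : ℝ≥0) * d m = h := fun m => by
    rw [hd]
    exact mul_div_cancel₀ _ (by positivity)
  set term : ℕ → ℕ → Ω → ℝ≥0∞ := fun m i ω =>
    truncIncr (N e) (t + i * d m) (d m) L ω ^ 2
      + 2 * (truncIncr (N e) t (i * d m) L ω * truncIncr (N e) (t + i * d m) (d m) L ω) with hterm
  have htm : ∀ m i, Measurable (term m i) := by
    intro m i
    have h1 : Measurable (truncIncr (N e) (t + i * d m) (d m) L) :=
      (measurable_truncIncr (X := X) le_rfl e L).mono (hM.history_le _) le_rfl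
    have h2 : Measurable (truncIncr (N e) t (i * d m) L) :=
      (measurable_truncIncr (X := X) le_rfl e L).mono (hM.history_le _) le_rfl
    exact (h1.pow_const _).add ((h2.mul h1).const_mul _)
  have hsets : ∀ m (i : ℕ), MeasurableSet (X (t + i * d m) ⁻¹' (F m)) := fun m i =>
    hM.measurable_state _ (Finset.measurableSet _)
  set T : ℕ → Ω → ℝ≥0∞ := fun m ω => ∑ i ∈ Finset.range (n m + 1),
    (X (t + i * d m) ⁻¹' (F m : Set (Fin C → ℤ))).indicator (term m i) ω with hT
  have hTm : ∀ m, Measurable (T m) := fun m =>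
    Finset.measurable_fun_sum _ fun i _ => (htm m i).indicator (hsets m i)
  have hile : ∀ m i, i ∈ Finset.range (n m + 1) → (i : ℝ≥0) * d m ≤ h := by
    intro m i hi
    rw [← hdn m]
    gcongr
    exact (Finset.mem_range.1 hi).le
  have hTint : ∀ m, ∫⁻ ω, T m ω ∂μ ≤ h * (M + ε * (1 + 2 * L)) := by
    intro m
    rw [hT, lintegral_finsetSum _ fun i _ => (htm m i).indicator (hsets m i)]
    calc _ ≤ ∑ i ∈ Finset.range (n m + 1), (d m : ℝ≥0∞) * (M + ε * (1 + 2 * L)) := by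
          refine Finset.sum_le_sum fun i hi => ?_
          rw [lintegral_indicator (hsets m i)]
          exact hK.lintegral_cell_le hM hx hD₁ hD₂ ha L (hile m i hi) (F m)
            fun y hy h0 => hn m y hy ⟨_, h0⟩
      _ = _ := by
          rw [Finset.sum_const, Finset.card_range, nsmul_eq_mul, ← mul_assoc]
          congr 1
          exact_mod_cast hdn m
  have hpt : ∀ ω, truncIncr (N e) t h L ω ^ 2 ≤ liminf (fun m => T m ω) atTop := by
    intro ω
    refine le_liminf_of_le (by isBoundedDefault) ?_
    have hev : ∀ᶠ m in atTop, ∀ y ∈ (fun u => X u ω) '' Set.Iic (t + h), y ∈ F m := by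
      refine (Filter.eventually_all_finite (hM.finite_states (t + h) ω)).2 fun y _ => ?_
      obtain ⟨k, rfl⟩ := henum y
      filter_upwards [eventually_gt_atTop k] with m hm
      exact Finset.mem_image_of_mem _ (Finset.mem_range.2 hm)
    filter_upwards [hev] with m hm
    have h1 := truncIncr_sq_le_sum (t := t) hM e (d m) L (n m + 1) ω
    rw [hdn m] at h1
    refine h1.trans (Finset.sum_le_sum fun i hi => ?_)
    rw [Set.indicator_of_mem]
    exact hm _ ⟨t + i * d m, by rw [Set.mem_Iic]; gcongr; exact hile m i hi, rfl⟩
  calc ∫⁻ ω, truncIncr (N e) t h L ω ^ 2 ∂μ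
      ≤ ∫⁻ ω, liminf (fun m => T m ω) atTop ∂μ := lintegral_mono hpt
    _ ≤ liminf (fun m => ∫⁻ ω, T m ω ∂μ) atTop := lintegral_liminf_le hTm
    _ ≤ h * (M + ε * (1 + 2 * L)) :=
        liminf_le_of_frequently_le' (Frequently.of_forall hTint)

end SecondMoment
-- Limits of the first two moments divided by h
section Limits

variable {C : ℕ} {Ω : Type*} [MeasurableSpace Ω] {X : ℝ≥0 → Ω → (Fin C → ℤ)}
  {N : Transition C → ℝ≥0 → Ω → ℕ} {P : Measure Ω}
  {K : ℝ≥0 → (Fin C → ℤ) → Measure (Transition C → ℕ)} {μ : Measure Ω} {t : ℝ≥0}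

lemma IsMarkovCountingSystem.eventually_incr_eq_zero (hM : IsMarkovCountingSystem P X N)
    (t : ℝ≥0) (ω : Ω) : ∀ᶠ h in 𝓝[>] (0 : ℝ≥0), incr N t h ω = 0 := by
  have h1 : Tendsto (fun h : ℝ≥0 => t + h) (𝓝[>] 0) (𝓝[≥] t) := by
    refine tendsto_nhdsWithin_iff.2 ⟨?_, Eventually.of_forall fun h => by
      rw [Set.mem_Ici]; exact le_self_add⟩
    have : Tendsto (fun h : ℝ≥0 => t + h) (𝓝 0) (𝓝 (t + 0)) :=
      tendsto_const_nhds.add tendsto_id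
    rw [add_zero] at this
    exact this.mono_left nhdsWithin_le_nhds
  filter_upwards [h1.eventually (hM.eventually_right t ω)] with h hh
  exact hM.incr_eq_zero_iff.2 hh

lemma IsMarkovCountingSystem.measurable_increment (hM : IsMarkovCountingSystem P X N)
    (e : Transition C) (t h : ℝ≥0) : Measurable (increment (N e) t h) :=
  (measurable_pi_apply e).comp (hM.measurable_incr t h)

lemma IsMarkovCountingSystem.measurable_increment_ennreal (hM : IsMarkovCountingSystem P X N)
    (e : Transition C) (t h : ℝ≥0) :
    Measurable fun ω => (increment (N e) t h ω : ℝ≥0∞) :=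
  (Measurable.of_discrete (f := fun n : ℕ => (n : ℝ≥0∞))).comp (hM.measurable_increment e t h)

lemma lintegral_increment_sq_le_of_trunc (hM : IsMarkovCountingSystem P X N) {e : Transition C}
    {h : ℝ≥0} {M : ℝ≥0∞} (H : ∀ L : ℕ, ∫⁻ ω, truncIncr (N e) t h L ω ^ 2 ∂μ ≤ M) :
    ∫⁻ ω, (increment (N e) t h ω : ℝ≥0∞) ^ 2 ∂μ ≤ M := by
  refine le_of_tendsto' (lintegral_tendsto_of_tendsto_of_monotone
    (f := fun (L : ℕ) ω => truncIncr (N e) t h L ω ^ 2) (fun L => ?_)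
    (Eventually.of_forall fun ω L L' hL => ?_) (Eventually.of_forall fun ω => ?_)) H
  · exact ((measurable_truncIncr (X := X) le_rfl e L).mono (hM.history_le _) le_rfl).pow_const _
      |>.aemeasurable
  · exact pow_le_pow_left' (Nat.cast_le.2 (min_le_min_left _ hL)) 2
  · refine tendsto_const_nhds.congr' ?_
    filter_upwards [eventually_ge_atTop (increment (N e) t h ω)] with L hL
    rw [truncIncr, min_eq_left hL]

/-- The inequality 2ab ≤ a² + b² with a = D and b = 2hcg, scaled so that the cross term can be
absorbed into the second moment itself. -/
lemma lintegral_mul_le_lintegral_sq_add {D g : Ω → ℝ≥0∞} (hg : Measurable g) (h c : ℝ≥0) :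
    2 * (h * (2 * (c * ∫⁻ ω, D ω * g ω ∂μ)))
      ≤ ∫⁻ ω, D ω ^ 2 ∂μ + (2 * h * c) ^ 2 * ∫⁻ ω, g ω ^ 2 ∂μ := by
  have hc : (2 * h * c : ℝ≥0∞) ≠ ∞ := by finiteness
  calc 2 * (h * (2 * (c * ∫⁻ ω, D ω * g ω ∂μ)))
      = ∫⁻ ω, (2 * (2 * h * c)) * (D ω * g ω) ∂μ := by
        rw [lintegral_const_mul' _ _ (by finiteness)]
        ring
    _ ≤ ∫⁻ ω, (D ω ^ 2 + (2 * h * c) ^ 2 * g ω ^ 2) ∂μ := by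
        refine lintegral_mono fun ω => ?_
        calc (2 * (2 * h * c)) * (D ω * g ω) = 2 * (D ω * ((2 * h * c) * g ω)) := by ring
          _ ≤ D ω ^ 2 + ((2 * h * c) * g ω) ^ 2 := ENNReal.two_mul_mul_le_add_sq _ _
          _ = _ := by rw [mul_pow]
    _ = _ := by
        rw [lintegral_add_right _ ((hg.pow_const _).const_mul _),
          lintegral_const_mul' _ _ (by finiteness)]

/-- A linear bound for the conditional second moment of the increments over short intervals. -/
lemma MarkovFrom.exists_lintegral_increment_sq_le (hM : IsMarkovCountingSystem P X N)
    (hK : MarkovFrom X N K μ t) [IsProbabilityMeasure μ]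
    {q : Transition C → (Fin C → ℤ) → ℕ+ → ℝ≥0} {lam : (Fin C → ℤ) → ℝ≥0}
    (hR : ∀ s y, μ (X s ⁻¹' {y}) ≠ 0 → IsRegularState (fun h => K h y) (fun e => q e y) (lam y))
    {x : Fin C → ℤ} (hx : ∀ᵐ ω ∂μ, X t ω = x) {a : ℝ≥0} {e : Transition C} {g : Ω → ℝ≥0∞}
    (hg : Measurable g) (hg2 : ∫⁻ ω, g ω ^ 2 ∂μ ≠ ∞) {c₁ c₂ : ℝ≥0}
    (hD₁ : DominatesAt X N μ t a (fun y => rateMoment (fun e => q e y) e 1) g c₁)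
    (hD₂ : DominatesAt X N μ t a (fun y => rateMoment (fun e => q e y) e 2) (fun ω => g ω ^ 2) c₂)
    (hm : rateMoment (fun e => q e x) e 2 ≠ ∞) :
    ∃ B : ℝ≥0, ∀ h : ℝ≥0, 0 < h → h ≤ a →
      ∫⁻ ω, (increment (N e) t h ω : ℝ≥0∞) ^ 2 ∂μ ≤ h * B := by
  set m₂ := rateMoment (fun e => q e x) e 2
  set G := ∫⁻ ω, g ω ^ 2 ∂μ
  have hB : 2 * (m₂ + c₂ * G) + 4 * a * c₁ ^ 2 * G ≠ ∞ := by finiteness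
  refine ⟨(2 * (m₂ + c₂ * G) + 4 * a * c₁ ^ 2 * G).toNNReal, fun h hpos ha => ?_⟩
  rw [ENNReal.coe_toNNReal hB]
  refine lintegral_increment_sq_le_of_trunc hM fun L => ?_
  set I := ∫⁻ ω, truncIncr (N e) t h L ω ^ 2 ∂μ with hI
  have hIfin : I ≠ ∞ := by
    refine ((lintegral_mono fun ω => pow_le_pow_left' (truncIncr_le (N e) t h L ω) 2).trans_lt ?_).ne
    rw [lintegral_const, measure_univ, mul_one]
    finiteness
  have h1 := hK.lintegral_truncIncr_sq_le hM hR hx hD₁ hD₂ hpos ha L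
  have h2 := lintegral_mul_le_lintegral_sq_add (μ := μ) (D := truncIncr (N e) t h L) hg h c₁
  have h3 : ∫⁻ ω in {ω | incr N t h ω ≠ 0}, g ω ^ 2 ∂μ ≤ G := setLIntegral_le_lintegral _ _
  refine (ENNReal.add_le_add_iff_left hIfin).1 ?_
  calc I + I = 2 * I := (two_mul I).symm
    _ ≤ 2 * (h * (m₂ + c₂ * ∫⁻ ω in {ω | incr N t h ω ≠ 0}, g ω ^ 2 ∂μ
        + 2 * (c₁ * ∫⁻ ω, truncIncr (N e) t h L ω * g ω ∂μ))) := by gcongr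
    _ = h * (2 * (m₂ + c₂ * ∫⁻ ω in {ω | incr N t h ω ≠ 0}, g ω ^ 2 ∂μ))
        + 2 * (h * (2 * (c₁ * ∫⁻ ω, truncIncr (N e) t h L ω * g ω ∂μ))) := by ring
    _ ≤ h * (2 * (m₂ + c₂ * G)) + (I + (2 * h * c₁) ^ 2 * G) := by gcongr
    _ = I + h * (2 * (m₂ + c₂ * G) + 4 * h * c₁ ^ 2 * G) := by ring
    _ ≤ I + h * (2 * (m₂ + c₂ * G) + 4 * a * c₁ ^ 2 * G) := by gcongr

lemma lintegral_increment_eq (hM : IsMarkovCountingSystem P X N) (hK : MarkovFrom X N K μ t)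
    [IsProbabilityMeasure μ] {x : Fin C → ℤ} (hx : ∀ᵐ ω ∂μ, X t ω = x) (h : ℝ≥0)
    (φ : (Transition C → ℕ) → ℝ≥0∞) : ∫⁻ ω, φ (incr N t h ω) ∂μ = ∫⁻ n, φ n ∂K h x := by
  have h1 := hK.lintegral hM le_rfl h x (w := fun _ => 1) measurable_const φ
  have h2 : μ.restrict (X t ⁻¹' {x}) = μ := Measure.restrict_eq_self_of_ae_mem hx
  simpa [h2] using h1

/-- Fatou-type bound: finitely many single-type events already bring the sum above b, and each of
them contributes its rate in the limit. -/
lemma eventually_lt_moment (hM : IsMarkovCountingSystem P X N) (hK : MarkovFrom X N K μ t)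
    [IsProbabilityMeasure μ] {q : Transition C → ℕ+ → ℝ≥0} {l : ℝ≥0} {x : Fin C → ℤ}
    (hx : ∀ᵐ ω ∂μ, X t ω = x) (hR : IsRegularState (fun h => K h x) q l) (e : Transition C)
    (p : ℕ) {b : ℝ≥0∞} (hb : b < rateMoment q e p) :
    ∀ᶠ h : ℝ≥0 in 𝓝[>] 0, b < (∫⁻ ω, (increment (N e) t h ω : ℝ≥0∞) ^ p ∂μ) / h := by
  rw [rateMoment, ENNReal.tsum_eq_iSup_sum] at hb
  obtain ⟨S, hS⟩ := lt_iSup_iff.1 hb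
  have hlim : Tendsto (fun h : ℝ≥0 => ∑ k ∈ S, (k : ℝ≥0∞) ^ p * (K h x {singleEvent (e, k)} / h))
      (𝓝[>] 0) (𝓝 (∑ k ∈ S, (k : ℝ≥0∞) ^ p * q e k)) :=
    tendsto_finsetSum _ fun k _ => ENNReal.Tendsto.const_mul (hR.single (e, k))
      (Or.inr (by finiteness))
  filter_upwards [hlim.eventually_const_lt hS] with h hh
  refine hh.trans_le ?_
  have hsum : ∑ k ∈ S, (k : ℝ≥0∞) ^ p * (K h x {singleEvent (e, k)} / h)
      = (∑ k ∈ S, (k : ℝ≥0∞) ^ p * K h x {singleEvent (e, k)}) / h := by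
    simp only [div_eq_mul_inv, Finset.sum_mul, mul_assoc]
  rw [hsum]
  gcongr
  have h1 := lintegral_increment_eq hM hK hx h fun n => (n e : ℝ≥0∞) ^ p
  simp only [incr] at h1
  rw [h1]
  calc ∑ k ∈ S, (k : ℝ≥0∞) ^ p * K h x {singleEvent (e, k)}
      = ∑ k ∈ S, ∫⁻ n in {singleEvent (e, k)}, (n e : ℝ≥0∞) ^ p ∂K h x := by
        refine Finset.sum_congr rfl fun k _ => ?_
        rw [lintegral_singleton]
        simp [singleEvent]
    _ = ∫⁻ n in ⋃ k ∈ S, {singleEvent (e, k)}, (n e : ℝ≥0∞) ^ p ∂K h x := by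
        rw [lintegral_biUnion_finset]
        · intro k _ k' _ hkk'
          refine Set.disjoint_singleton.2 fun h => hkk' ?_
          exact (Prod.mk.inj (singleEvent_injective h)).2
        · exact fun k _ => measurableSet_singleton _
    _ ≤ _ := setLIntegral_le_lintegral _ _

/-- On each path no event occurs in [t, t + h] for small h, so both error integrals vanish by
dominated convergence. The product ΔN·g is dominated by the square of the increment over [t, t + a]
plus g², integrable by the linear bound at h = a. -/
lemma MarkovFrom.tendsto_second_moment (hM : IsMarkovCountingSystem P X N)
    (hK : MarkovFrom X N K μ t) [IsProbabilityMeasure μ]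
    {q : Transition C → (Fin C → ℤ) → ℕ+ → ℝ≥0} {lam : (Fin C → ℤ) → ℝ≥0}
    (hR : ∀ s y, μ (X s ⁻¹' {y}) ≠ 0 → IsRegularState (fun h => K h y) (fun e => q e y) (lam y))
    {x : Fin C → ℤ} (hx : ∀ᵐ ω ∂μ, X t ω = x) {a : ℝ≥0} (ha : 0 < a) {e : Transition C}
    {g : Ω → ℝ≥0∞}
    (hg : Measurable g) (hg2 : ∫⁻ ω, g ω ^ 2 ∂μ ≠ ∞) {c₁ c₂ : ℝ≥0}
    (hD₁ : DominatesAt X N μ t a (fun y => rateMoment (fun e => q e y) e 1) g c₁)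
    (hD₂ : DominatesAt X N μ t a (fun y => rateMoment (fun e => q e y) e 2) (fun ω => g ω ^ 2) c₂)
    (hm : rateMoment (fun e => q e x) e 2 ≠ ∞) :
    Tendsto (fun h : ℝ≥0 => (∫⁻ ω, (increment (N e) t h ω : ℝ≥0∞) ^ 2 ∂μ) / h) (𝓝[>] 0)
      (𝓝 (rateMoment (fun e => q e x) e 2)) := by
  have hRx : IsRegularState (fun h => K h x) (fun e => q e x) (lam x) := by
    refine hR t x ?_
    rw [(prob_compl_eq_zero_iff (hM.measurable_state t (measurableSet_singleton x))).1 hx]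
    exact one_ne_zero
  obtain ⟨B, hB⟩ := hK.exists_lintegral_increment_sq_le hM hR hx hg hg2 hD₁ hD₂ hm
  have hsmall : ∀ᶠ h : ℝ≥0 in 𝓝[>] 0, h ≤ a :=
    nhdsWithin_le_nhds (Iic_mem_nhds ha)
  have hDm := fun h => hM.measurable_increment_ennreal e t h
  have hlim₂ : Tendsto (fun h : ℝ≥0 => ∫⁻ ω in {ω | incr N t h ω ≠ 0}, g ω ^ 2 ∂μ) (𝓝[>] 0)
      (𝓝 (∫⁻ _, 0 ∂μ)) := by
    have hE : ∀ h, MeasurableSet {ω | incr N t h ω ≠ 0} := fun h =>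
      hM.measurable_incr t h (measurableSet_singleton 0).compl
    simp_rw [← lintegral_indicator (hE _)]
    refine tendsto_lintegral_filter_of_dominated_convergence (fun ω => g ω ^ 2)
      (Eventually.of_forall fun h => (hg.pow_const _).indicator (hE h))
      (Eventually.of_forall fun h => Eventually.of_forall fun ω => Set.indicator_le_self _ _ _)
      hg2 (Eventually.of_forall fun ω => ?_)
    refine tendsto_const_nhds.congr' ?_
    filter_upwards [hM.eventually_incr_eq_zero t ω] with h hh
    rw [Set.indicator_of_notMem]
    exact fun hne => hne hh
  have hlim₁ : Tendsto (fun h : ℝ≥0 => ∫⁻ ω, (increment (N e) t h ω : ℝ≥0∞) * g ω ∂μ) (𝓝[>] 0)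
      (𝓝 (∫⁻ _, 0 ∂μ)) := by
    refine tendsto_lintegral_filter_of_dominated_convergence
      (fun ω => (increment (N e) t a ω : ℝ≥0∞) ^ 2 + g ω ^ 2)
      (Eventually.of_forall fun h => (hDm h).mul hg) ?_ ?_ (Eventually.of_forall fun ω => ?_)
    · filter_upwards [hsmall] with h hh
      refine Eventually.of_forall fun ω => ?_
      have h1 : (increment (N e) t h ω : ℝ≥0∞) ≤ increment (N e) t a ω :=
        Nat.cast_le.2 (Nat.sub_le_sub_right (hM.count_mono e ω (by gcongr)) _)
      calc (increment (N e) t h ω : ℝ≥0∞) * g ω ≤ increment (N e) t a ω * g ω := by gcongr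
        _ ≤ 2 * (increment (N e) t a ω * g ω) := by
          rw [two_mul]
          exact le_self_add
        _ ≤ _ := ENNReal.two_mul_mul_le_add_sq _ _
    · rw [lintegral_add_right _ (hg.pow_const _)]
      refine ENNReal.add_ne_top.2 ⟨ne_top_of_le_ne_top ?_ (hB a ha le_rfl), hg2⟩
      finiteness
    · refine tendsto_const_nhds.congr' ?_
      filter_upwards [hM.eventually_incr_eq_zero t ω] with h hh
      rw [show increment (N e) t h ω = 0 from congr_fun hh e, Nat.cast_zero, zero_mul]
  rw [lintegral_zero] at hlim₁ hlim₂
  have hup : Tendsto (fun h : ℝ≥0 => rateMoment (fun e => q e x) e 2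
        + c₂ * ∫⁻ ω in {ω | incr N t h ω ≠ 0}, g ω ^ 2 ∂μ
        + 2 * (c₁ * ∫⁻ ω, (increment (N e) t h ω : ℝ≥0∞) * g ω ∂μ)) (𝓝[>] 0)
      (𝓝 (rateMoment (fun e => q e x) e 2 + c₂ * 0 + 2 * (c₁ * 0))) :=
    (tendsto_const_nhds.add (ENNReal.Tendsto.const_mul hlim₂ (Or.inr ENNReal.coe_ne_top))).add
      (ENNReal.Tendsto.const_mul (ENNReal.Tendsto.const_mul hlim₁ (Or.inr ENNReal.coe_ne_top))
        (Or.inr (by simp)))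
  simp only [mul_zero, add_zero] at hup
  refine tendsto_order.2 ⟨fun b hb => eventually_lt_moment hM hK hx hRx e 2 hb, fun b hb => ?_⟩
  filter_upwards [hup.eventually_lt_const hb, hsmall, self_mem_nhdsWithin] with h hh hha hpos
  refine lt_of_le_of_lt ?_ hh
  refine ENNReal.div_le_of_le_mul' (lintegral_increment_sq_le_of_trunc hM fun L => ?_)
  refine (hK.lintegral_truncIncr_sq_le hM hR hx hD₁ hD₂ hpos hha L).trans ?_
  gcongr with ω
  exact Nat.cast_le.2 (min_le_left _ _)

lemma rateMoment_mono (q : Transition C → ℕ+ → ℝ≥0) (e : Transition C) {p p' : ℕ} (h : p ≤ p') :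
    rateMoment q e p ≤ rateMoment q e p' := by
  refine ENNReal.tsum_le_tsum fun k => ?_
  gcongr
  · exact Nat.one_le_cast.2 k.pos

/-- If the second moments of the increments are of linear order, the first ones have the expected
infinitesimal behaviour. -/
lemma tendsto_first_moment (hM : IsMarkovCountingSystem P X N) (hK : MarkovFrom X N K μ t)
    [IsProbabilityMeasure μ] {q : Transition C → ℕ+ → ℝ≥0} {l : ℝ≥0} {x : Fin C → ℤ}
    (hx : ∀ᵐ ω ∂μ, X t ω = x) (hR : IsRegularState (fun h => K h x) q l) (e : Transition C)
    {B : ℝ≥0} (hB : ∀ᶠ h : ℝ≥0 in 𝓝[>] 0, ∫⁻ ω, (increment (N e) t h ω : ℝ≥0∞) ^ 2 ∂μ ≤ h * B) :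
    Tendsto (fun h : ℝ≥0 => (∫⁻ ω, (increment (N e) t h ω : ℝ≥0∞) ∂μ) / h) (𝓝[>] 0)
      (𝓝 (rateMoment q e 1)) := by
  refine tendsto_order.2 ⟨fun b hb => ?_, fun b hb => ?_⟩
  · simpa using eventually_lt_moment hM hK hx hR e 1 hb
  obtain ⟨r, hr, hrb⟩ := ENNReal.lt_iff_exists_add_pos_lt.1 hb
  -- Uniform integrability: D ≤ min(D, L+1) + D²/(L+1). This choice of `L` bounds the tail by hr/2,
  -- and the truncation error takes the other half of `r`.
  obtain ⟨L, hL⟩ := exists_nat_ge (B / (r / 2))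
  have hLr : B ≤ (L + 1 : ℕ) * (r / 2) := by
    rw [div_le_iff₀ (by positivity)] at hL
    refine hL.trans ?_
    gcongr
    exact Nat.le_succ L
  have htr := hR.eventually_trunc_le e (L + 1) 0 (ε := (r / 2 : ℝ≥0)) (by
    have : 0 < r / 2 := by positivity
    exact_mod_cast this)
  filter_upwards [hB, htr] with h hBh hh
  refine lt_of_le_of_lt (ENNReal.div_le_of_le_mul' ?_) hrb
  simp only [zero_add, pow_one] at hh
  rw [← lintegral_increment_eq hM hK hx h fun n => ((min (n e) (L + 1) : ℕ) : ℝ≥0∞)] at hh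
  have hpt : ∀ ω, ((L + 1 : ℕ) : ℝ≥0∞) * increment (N e) t h ω
      ≤ ((L + 1 : ℕ) : ℝ≥0∞) * ((min (incr N t h ω e) (L + 1) : ℕ) : ℝ≥0∞)
        + (increment (N e) t h ω : ℝ≥0∞) ^ 2 := by
    intro ω
    suffices (L + 1) * increment (N e) t h ω
        ≤ (L + 1) * min (incr N t h ω e) (L + 1) + increment (N e) t h ω ^ 2 by exact_mod_cast this
    rcases le_total (increment (N e) t h ω) (L + 1) with hle | hle
    · rw [show incr N t h ω e = increment (N e) t h ω from rfl, min_eq_left hle]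
      exact Nat.le_add_right _ _
    · rw [sq]
      exact (Nat.mul_le_mul_right _ hle).trans (Nat.le_add_left _ _)
  have hmain := lintegral_mono (μ := μ) hpt
  have hmeas : Measurable fun ω => ((L + 1 : ℕ) : ℝ≥0∞)
      * ((min (incr N t h ω e) (L + 1) : ℕ) : ℝ≥0∞) :=
    (Measurable.of_discrete (f := fun n : Transition C → ℕ => ((L + 1 : ℕ) : ℝ≥0∞)
      * ((min (n e) (L + 1) : ℕ) : ℝ≥0∞))).comp (hM.measurable_incr t h)
  rw [lintegral_const_mul' _ _ (ENNReal.natCast_ne_top _), lintegral_add_left hmeas,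
    lintegral_const_mul' _ _ (ENNReal.natCast_ne_top _)] at hmain
  have hL0 : ((L + 1 : ℕ) : ℝ≥0∞) ≠ 0 := by simp
  refine (ENNReal.mul_le_mul_iff_right hL0 (ENNReal.natCast_ne_top _)).1 (hmain.trans ?_)
  have hLr' : (B : ℝ≥0∞) ≤ ((L + 1 : ℕ) : ℝ≥0∞) * (r / 2 : ℝ≥0) := by exact_mod_cast hLr
  calc _ ≤ ((L + 1 : ℕ) : ℝ≥0∞) * (h * (rateMoment q e 1 + (r / 2 : ℝ≥0)))
        + h * (((L + 1 : ℕ) : ℝ≥0∞) * (r / 2 : ℝ≥0)) := by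
        refine add_le_add (mul_le_mul' le_rfl hh) (hBh.trans ?_)
        gcongr
    _ = ((L + 1 : ℕ) : ℝ≥0∞) * (h * (rateMoment q e 1 + ((r / 2 : ℝ≥0) + (r / 2 : ℝ≥0)))) := by
        ring
    _ = _ := by rw [← ENNReal.coe_add, add_halves]

end Limits
-- Simplicity at a state in terms of the rates
section Simple

variable {C : ℕ} {Ω : Type*} [MeasurableSpace Ω] {X : ℝ≥0 → Ω → (Fin C → ℤ)}
  {N : Transition C → ℝ≥0 → Ω → ℕ} {P : Measure Ω}
  {K : ℝ≥0 → (Fin C → ℤ) → Measure (Transition C → ℕ)} {μ : Measure Ω} {t : ℝ≥0}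

/-- Union bound over the cell in which the first event falls, with the state still equal to `x` at
its start. It shows that a state of rate 0 is absorbing, a case in which the domination argument has
no finite constant. -/
lemma MarkovFrom.measure_event_le (hM : IsMarkovCountingSystem P X N) (hK : MarkovFrom X N K μ t)
    [IsProbabilityMeasure μ] {x : Fin C → ℤ} (hx : ∀ᵐ ω ∂μ, X t ω = x)
    {q : Transition C → ℕ+ → ℝ≥0} {l : ℝ≥0} (hR : IsRegularState (fun h => K h x) q l)
    {h : ℝ≥0} (hpos : 0 < h) : μ {ω | incr N t h ω ≠ 0} ≤ h * l := by
  have hstep : ∀ (d : ℝ≥0) (i : ℕ), μ {ω | incr N t (i * d) ω ≠ 0} ≤ i * K d x {0}ᶜ := by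
    intro d i
    induction i with
    | zero =>
      refine le_of_eq_of_le ?_ zero_le
      have : {ω | incr N t ((0 : ℕ) * d) ω ≠ 0} = ∅ := by
        refine Set.eq_empty_of_forall_notMem fun ω hω => hω (hM.incr_eq_zero_iff.2 fun e => ?_)
        simp
      rw [this, measure_empty]
    | succ i ih =>
      have hsub : ({ω | incr N t ((i + 1 : ℕ) * d) ω ≠ 0} : Set Ω) ≤ᵐ[μ]
          ({ω | incr N t (i * d) ω ≠ 0} ∪ (Set.univ ∩ X t ⁻¹' {x} ∩ incr N t (i * d) ⁻¹' {0}
            ∩ incr N (t + i * d) d ⁻¹' {0}ᶜ) : Set Ω) := by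
        filter_upwards [hx] with ω hxω hω
        by_cases h0 : incr N t (i * d) ω = 0
        · refine Or.inr ⟨⟨⟨trivial, hxω⟩, h0⟩, fun h1 => hω ?_⟩
          rw [Nat.cast_succ, add_mul, one_mul, hM.incr_add, h0, Set.mem_singleton_iff.1 h1, add_zero]
        · exact Or.inl h0
      refine (measure_mono_ae hsub).trans ((measure_union_le _ _).trans ?_)
      rw [(hK.no_event_grid hM le_rfl d x MeasurableSet.univ i).2, Nat.cast_succ, add_mul, one_mul]
      refine add_le_add ih ?_
      have h1 : K d x {0} ^ i ≤ 1 := pow_le_one₀ zero_le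
        ((measure_mono (Set.subset_univ _)).trans (hR.univ d).le)
      calc _ ≤ (1 : ℝ≥0∞) * 1 * K d x {0}ᶜ := by gcongr; exact prob_le_one
        _ = _ := by ring
  refine ge_of_tendsto' (tendsto_mul_mesh hpos hR.event) fun n => ?_
  have := hstep (h / ((n + 1 : ℕ) : ℝ≥0)) (n + 1)
  rwa [mul_div_cancel₀ _ (by positivity)] at this

/-- If a jump of size at least 2 leaves `x` at time s, then on every fine enough grid the cell
containing s starts at `x` and has at least two events. Vanishing rates give such a cell probability
o(d), so the union over the cells of a bounded interval has probability tending to 0. -/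
lemma MarkovFrom.isSimpleAt [IsProbabilityMeasure P] (hM : IsMarkovCountingSystem P X N)
    (hK : MarkovFrom X N K P 0) {x : Fin C → ℤ} {q : Transition C → ℕ+ → ℝ≥0} {l : ℝ≥0}
    (hR : IsRegularState (fun h => K h x) q l) {e : Transition C}
    (hq : ∀ k : ℕ+, 2 ≤ (k : ℕ) → q e k = 0) : IsSimpleAt P X (N e) x := by
  set U : ℝ≥0 → ℕ → Set Ω := fun T n => ⋃ i ∈ Finset.range (n + 1),
    (Set.univ ∩ X (i * (T / ((n + 1 : ℕ) : ℝ≥0))) ⁻¹' {x} ∩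
      incr N (i * (T / ((n + 1 : ℕ) : ℝ≥0))) (T / ((n + 1 : ℕ) : ℝ≥0)) ⁻¹' {n | 2 ≤ n e}) with hU
  have hnull : ∀ (T : ℝ≥0) (m : ℕ), 0 < T → P (⋂ n ∈ Set.Ici m, U T n) = 0 := by
    intro T m hT
    have hφ : ∑' k : ℕ+, (((if 2 ≤ (k : ℕ) then 1 else 0 : ℝ≥0) : ℝ≥0) : ℝ≥0∞) * q e k = 0 := by
      refine ENNReal.tsum_eq_zero.2 fun k => ?_
      split_ifs with h
      · simp [hq k h]
      · simp
    refine le_antisymm (ENNReal.le_of_forall_pos_le_add fun ε hε _ => ?_) zero_le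
    have hev := hR.eventually_lintegral_le (φ := fun n => if 2 ≤ n then 1 else 0) (by simp)
      (B := 1) (fun n => by split_ifs <;> simp) e (ε := (ε / T : ℝ≥0))
      (by have : 0 < ε / T := by positivity
          exact_mod_cast this)
    obtain ⟨n, hn, hmn⟩ := (((tendsto_mesh hT).eventually hev).and (eventually_ge_atTop m)).exists
    set d := T / ((n + 1 : ℕ) : ℝ≥0) with hd
    rw [hφ, zero_add] at hn
    have hKd : K d x {n | 2 ≤ n e} ≤ d * (ε / T : ℝ≥0) := by
      refine le_trans (le_of_eq ?_) hn
      rw [← lintegral_indicator_one MeasurableSet.of_discrete]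
      refine lintegral_congr fun n => ?_
      by_cases h : 2 ≤ n e <;> simp [h]
    rw [zero_add]
    calc P (⋂ n ∈ Set.Ici m, U T n) ≤ P (U T n) := measure_mono (Set.biInter_subset_of_mem hmn)
      _ ≤ ∑ i ∈ Finset.range (n + 1), (d * (ε / T : ℝ≥0) : ℝ≥0∞) := by
          refine (measure_biUnion_finset_le _ _).trans (Finset.sum_le_sum fun i _ => ?_)
          rw [hK _ d x Set.univ _ zero_le MeasurableSet.univ]
          calc _ ≤ 1 * K d x {n | 2 ≤ n e} := by gcongr; exact prob_le_one
            _ ≤ _ := by rwa [one_mul]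
      _ = ε := by
          rw [Finset.sum_const, Finset.card_range, nsmul_eq_mul, ← mul_assoc]
          have : ((n + 1 : ℕ) : ℝ≥0) * d * (ε / T) = ε := by
            rw [hd, mul_div_cancel₀ _ (by positivity), mul_div_cancel₀ _ hT.ne']
          exact_mod_cast this
  have hae : ∀ᵐ ω ∂P, ∀ T m : ℕ, ω ∉ ⋂ n ∈ Set.Ici m, U (T + 1 : ℕ) n :=
    ae_all_iff.2 fun T => ae_all_iff.2 fun m =>
      measure_eq_zero_iff_ae_notMem.1 (hnull _ m (by positivity))
  filter_upwards [hae] with ω hω s hsx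
  by_contra! hj
  have hs : 0 < s := by
    rcases eq_or_ne s 0 with rfl | h
    · rw [IsMarkovCountingSystem.jump_zero] at hj
      omega
    · exact pos_of_ne_zero h
  obtain ⟨T, hT⟩ := exists_nat_ge s
  have hsT : s ≤ 0 + ((T + 1 : ℕ) : ℝ≥0) := by
    rw [zero_add]
    exact hT.trans (by exact_mod_cast Nat.le_succ T)
  obtain ⟨v, hvs, hv⟩ := (mem_nhdsLT_iff_exists_Ioo_subset' hs).1
    ((hM.eventually_left_state hs ω).and (hM.eventually_left s ω))
  have hmesh : ∀ᶠ n : ℕ in atTop, ((T + 1 : ℕ) : ℝ≥0) / ((n + 1 : ℕ) : ℝ≥0) < s - v :=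
    ((tendsto_mesh (by positivity)).mono_right nhdsWithin_le_nhds).eventually_lt_const
      (tsub_pos_of_lt hvs)
  obtain ⟨m, hm⟩ := eventually_atTop.1 hmesh
  refine hω T m (Set.mem_iInter₂.2 fun n hn => ?_)
  obtain ⟨i, hi, his, hsi⟩ := exists_cell hs hsT n.succ_pos
  rw [Nat.succ_eq_add_one, zero_add] at his hsi
  have hmn := hm n hn
  rw [hU]
  set d := ((T + 1 : ℕ) : ℝ≥0) / ((n + 1 : ℕ) : ℝ≥0) with hd
  have hvi : v < i * d := by
    have h1 : v + d < s := by
      rw [add_comm]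
      exact lt_tsub_iff_right.1 hmn
    exact lt_of_add_lt_add_right (h1.trans_le hsi)
  obtain ⟨hX, hN⟩ := hv ⟨hvi, his⟩
  refine Set.mem_biUnion (Finset.mem_coe.2 (Finset.mem_range.2 hi)) ⟨⟨trivial, hX.trans hsx⟩, ?_⟩
  have h1 : N e s ω ≤ N e (i * d + d) ω := hM.count_mono e ω hsi
  have h2 := hN e
  rw [jump] at hj
  change 2 ≤ N e (i * d + d) ω - N e (i * d) ω
  omega

/-- With a = 1, the first-event lower bound would otherwise give positive probability to a k-fold
jump out of `x`. -/
lemma MarkovFrom.rate_eq_zero_of_isSimpleAt [IsProbabilityMeasure P]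
    (hM : IsMarkovCountingSystem P X N)
    (hK : MarkovFrom X N K P 0) {x : Fin C → ℤ} {q : Transition C → ℕ+ → ℝ≥0} {l : ℝ≥0}
    (hR : IsRegularState (fun h => K h x) q l) (hp : IsPossible P X t x) {e : Transition C}
    (hS : IsSimpleAt P X (N e) x) {k : ℕ+} (hk : 2 ≤ (k : ℕ)) : q e k = 0 := by
  obtain ⟨B, -, hB, hle⟩ := hK.exists_firstEventSet hM (zero_le (a := t)) hR one_pos (e, k)
  have h0 : P (Set.univ ∩ X t ⁻¹' {x} ∩ B) = 0 := by
    have hS' : P {ω | ¬ ∀ s, Function.leftLim (fun u => X u ω) s = x → jump (N e) s ω ≤ 1} = 0 := hS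
    refine measure_mono_null (fun ω hω => ?_) hS'
    rw [Set.mem_ofPred_eq]
    intro hsimple
    obtain ⟨τ, hτ, hconst, hτe⟩ := hB hω.2
    have h1 := hsimple τ ((hM.leftLim_state_of_const hτ.1 hconst).trans hω.1.2)
    rw [hM.jump_of_const hτ.1 hconst e, hτe e, singleEvent, Pi.single_eq_same,
      Nat.add_sub_cancel_left] at h1
    exact absurd (hk.trans h1) (by norm_num)
  have h1 := hle Set.univ MeasurableSet.univ
  rw [h0, zero_mul, Set.univ_inter, ENNReal.coe_one, one_mul] at h1
  have h2 := (mul_eq_zero.1 (le_antisymm h1 zero_le)).resolve_left hp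
  exact_mod_cast h2

/-- A counting process that is simple at every state that can occur is simple. -/
lemma IsMarkovCountingSystem.isSimpleCounting (hM : IsMarkovCountingSystem P X N)
    {e : Transition C} (h : ∀ t x, IsPossible P X t x → IsSimpleAt P X (N e) x) :
    IsSimpleCounting P (N e) := by
  -- Possibility is known almost surely only at countably many times. A dense sequence suffices: the
  -- path is constant just to the left of s, so X(s-) is its value at one of these times.
  have h1 : ∀ᵐ ω ∂P, ∀ n : ℕ, IsPossible P X (TopologicalSpace.denseSeq ℝ≥0 n)
      (X (TopologicalSpace.denseSeq ℝ≥0 n) ω) := by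
    refine ae_all_iff.2 fun n => ?_
    have h2 : ∀ᵐ ω ∂P, ∀ y, ¬ IsPossible P X (TopologicalSpace.denseSeq ℝ≥0 n) y →
        X (TopologicalSpace.denseSeq ℝ≥0 n) ω ≠ y := by
      refine ae_all_iff.2 fun y => ?_
      by_cases hy : IsPossible P X (TopologicalSpace.denseSeq ℝ≥0 n) y
      · exact Eventually.of_forall fun ω hn => absurd hy hn
      · have h0 : P (X (TopologicalSpace.denseSeq ℝ≥0 n) ⁻¹' {y}) = 0 := not_not.1 hy
        filter_upwards [measure_eq_zero_iff_ae_notMem.1 h0] with ω hω _ heq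
        exact hω heq
    filter_upwards [h2] with ω hω
    by_contra hne
    exact hω _ hne rfl
  have h3 : ∀ᵐ ω ∂P, ∀ x, (∃ t, IsPossible P X t x) →
      ∀ s, Function.leftLim (fun u => X u ω) s = x → jump (N e) s ω ≤ 1 := by
    refine ae_all_iff.2 fun x => ?_
    by_cases hx : ∃ t, IsPossible P X t x
    · obtain ⟨t, ht⟩ := hx
      filter_upwards [h t x ht] with ω hω _ using hω
    · exact Eventually.of_forall fun ω hn => absurd hn hx
  filter_upwards [h1, h3] with ω hω1 hω3 s
  rcases eq_or_ne s 0 with rfl | hs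
  · rw [jump_zero]
    exact zero_le_one
  have hs : 0 < s := pos_of_ne_zero hs
  obtain ⟨v, hvs, hv⟩ := (mem_nhdsLT_iff_exists_Ioo_subset' hs).1 (hM.eventually_left_state hs ω)
  obtain ⟨n, hn⟩ := (TopologicalSpace.denseRange_denseSeq ℝ≥0).exists_mem_open
    isOpen_Ioo (Set.nonempty_Ioo.2 hvs)
  exact hω3 _ ⟨_, hω1 n⟩ s (hv hn).symm

end Simple
-- Dispersion index and conclusion
section Dispersion

variable {C : ℕ} {Ω : Type*} [MeasurableSpace Ω] {X : ℝ≥0 → Ω → (Fin C → ℤ)}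
  {N : Transition C → ℝ≥0 → Ω → ℕ} {P : Measure Ω}
  {K : ℝ≥0 → (Fin C → ℤ) → Measure (Transition C → ℕ)} {t : ℝ≥0}
  {q : Transition C → (Fin C → ℤ) → ℕ+ → ℝ≥0} {lam : (Fin C → ℤ) → ℝ≥0}

/-- Infinitesimal first and second moments of the increments, in a possible state. -/
lemma tendsto_moments [IsProbabilityMeasure P] (hM : IsMarkovCountingSystem P X N)
    (hSC : IsStableConservative P X N q lam) (hP4 : PropertyP4 P X N lam)
    (hK : MarkovFrom X N K P 0) (e : Transition C) {x : Fin C → ℤ} (hp : IsPossible P X t x) :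
    rateMoment (fun e => q e x) e 2 ≠ ∞ ∧
    Tendsto (fun h : ℝ≥0 => (∫⁻ ω, (increment (N e) t h ω : ℝ≥0∞) ∂(condState P X t x)) / h)
      (𝓝[>] 0) (𝓝 (rateMoment (fun e => q e x) e 1)) ∧
    Tendsto (fun h : ℝ≥0 => (∫⁻ ω, (increment (N e) t h ω : ℝ≥0∞) ^ 2 ∂(condState P X t x)) / h)
      (𝓝[>] 0) (𝓝 (rateMoment (fun e => q e x) e 2)) ∧
    ∀ᶠ h in 𝓝[>] (0 : ℝ≥0),
      ∫⁻ ω, (increment (N e) t h ω : ℝ≥0∞) ^ 2 ∂(condState P X t x) ≠ ∞ := by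
  have hprob : IsProbabilityMeasure (condState P X t x) := cond_isProbabilityMeasure hp
  have hxm : MeasurableSet (X t ⁻¹' {x}) := hM.measurable_state t (measurableSet_singleton x)
  have hx : ∀ᵐ ω ∂(condState P X t x), X t ω = x := ae_cond_mem hxm
  have hKc := hK.condState hM t x
  have hR : ∀ s y, condState P X t x (X s ⁻¹' {y}) ≠ 0 →
      IsRegularState (fun h => K h y) (fun e => q e y) (lam y) := fun s y hy =>
    isRegularState_of_isPossible hM hSC hK (t := s) fun h0 =>
      hy (cond_absolutelyContinuous h0)
  have hRx := isRegularState_of_isPossible hM hSC hK hp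
  set μ := condState P X t x with hμ
  suffices H : rateMoment (fun e => q e x) e 2 ≠ ∞ ∧
      (∃ B : ℝ≥0, ∀ᶠ h : ℝ≥0 in 𝓝[>] 0,
        ∫⁻ ω, (increment (N e) t h ω : ℝ≥0∞) ^ 2 ∂μ ≤ h * B) ∧
      Tendsto (fun h : ℝ≥0 => (∫⁻ ω, (increment (N e) t h ω : ℝ≥0∞) ^ 2 ∂μ) / h)
        (𝓝[>] 0) (𝓝 (rateMoment (fun e => q e x) e 2)) by
    obtain ⟨h1, ⟨B, hB⟩, h2⟩ := H
    exact ⟨h1, tendsto_first_moment hM hKc hx hRx e hB, h2,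
      hB.mono fun h hh => ne_top_of_le_ne_top (by finiteness) hh⟩
  -- A state of rate 0 is treated apart, since the domination constant involves the inverse of the
  -- rate.
  rcases eq_or_ne (lam x) 0 with hl | hl
  · have hq : ∀ k, q e x k = 0 := fun k => by
      have := le_hasSum hRx.hasSum (e, k) fun _ _ => zero_le
      rw [hl] at this
      exact le_antisymm this zero_le
    have hm : rateMoment (fun e => q e x) e 2 = 0 :=
      ENNReal.tsum_eq_zero.2 fun k => by simp [hq k]
    have hzero : ∀ᶠ h : ℝ≥0 in 𝓝[>] 0,
        ∫⁻ ω, (increment (N e) t h ω : ℝ≥0∞) ^ 2 ∂μ = 0 := by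
      filter_upwards [self_mem_nhdsWithin] with h hpos
      have h0 := hKc.measure_event_le hM hx hRx hpos
      rw [hl, ENNReal.coe_zero, mul_zero] at h0
      have h1 : ∀ᵐ ω ∂μ, incr N t h ω = 0 := le_antisymm h0 zero_le
      rw [← lintegral_zero (μ := μ)]
      refine lintegral_congr_ae ?_
      filter_upwards [h1] with ω hω
      rw [show increment (N e) t h ω = 0 from congr_fun hω e]
      simp
    rw [hm]
    refine ⟨ENNReal.zero_ne_top, ⟨0, hzero.mono fun h hh => hh.le.trans zero_le⟩, ?_⟩
    refine tendsto_const_nhds.congr' ?_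
    filter_upwards [hzero] with h hh
    rw [hh, ENNReal.zero_div]
  · obtain ⟨b, hb, hv⟩ := hP4 t x hp e
    -- Half of the window of P4 is for the times s, half for the first event after s.
    set a := b / 2 with ha
    have hapos : 0 < a := by positivity
    have hab : a + a = b := add_halves b
    have hv' := lintegral_sq_ne_top_of_evariance (f := fun ω =>
      supJump (N e) t b ω * supRate X lam t b ω) (fun ω => ENNReal.mul_ne_top
        (hM.supJump_lt_top e t b ω).ne (hM.supRate_lt_top lam t b ω).ne) hv
    rw [← hab] at hv'
    obtain ⟨g, hg, hg2, hD⟩ := hKc.exists_dominatesAt hM hR hx (pos_of_ne_zero hl) hapos e hv'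
    obtain ⟨c₁, hD₁⟩ := hD 0
    obtain ⟨c₂, hD₂⟩ := hD 1
    simp only [zero_add, pow_one] at hD₁
    -- Domination at the initial time, where the state is `x` with mass 1.
    have hm : rateMoment (fun e => q e x) e 2 ≠ ∞ := by
      have h1 := hD₂ t x (fun _ => 1) le_rfl le_self_add measurable_const
      have h2 : μ.restrict (X t ⁻¹' {x}) = μ := Measure.restrict_eq_self_of_ae_mem hx
      simp only [h2, lintegral_const, measure_univ, mul_one, one_mul] at h1
      exact ne_top_of_le_ne_top (ENNReal.mul_ne_top ENNReal.coe_ne_top hg2) h1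
    obtain ⟨B, hB⟩ := hKc.exists_lintegral_increment_sq_le hM hR hx hg hg2 hD₁ hD₂ hm
    refine ⟨hm, ⟨B, ?_⟩, hKc.tendsto_second_moment hM hR hx hapos hg hg2 hD₁ hD₂ hm⟩
    filter_upwards [self_mem_nhdsWithin, nhdsWithin_le_nhds (Iic_mem_nhds hapos)] with h h1 h2
    exact hB h h1 h2

/-- The squared mean divided by h equals h times the square of the mean per unit time, so it tends
to 0, and the infinitesimal variance equals the infinitesimal second moment. -/
lemma hasDispersionIndex_iff [IsProbabilityMeasure P] (hM : IsMarkovCountingSystem P X N)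
    (hSC : IsStableConservative P X N q lam) (hP4 : PropertyP4 P X N lam)
    (hK : MarkovFrom X N K P 0) (e : Transition C) {x : Fin C → ℤ} (hp : IsPossible P X t x)
    (D : ℝ) :
    HasDispersionIndex P X (N e) t x D ↔ (rateMoment (fun e => q e x) e 1).toReal ≠ 0 ∧
      D = (rateMoment (fun e => q e x) e 2).toReal / (rateMoment (fun e => q e x) e 1).toReal := by
  have hprob : IsProbabilityMeasure (condState P X t x) := cond_isProbabilityMeasure hp
  obtain ⟨hm₂, h1, h2, hfin⟩ := tendsto_moments hM hSC hP4 hK e hp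
  have hm₁ : rateMoment (fun e => q e x) e 1 ≠ ∞ :=
    ne_top_of_le_ne_top hm₂ (rateMoment_mono _ _ (by norm_num))
  set μ := condState P X t x
  have hmeas : ∀ h, Measurable fun ω => (increment (N e) t h ω : ℝ) := fun h =>
    (Measurable.of_discrete (f := fun n : ℕ => (n : ℝ))).comp (hM.measurable_increment e t h)
  have hint : ∀ (h : ℝ≥0) (p : ℕ), ∫ ω, (increment (N e) t h ω : ℝ) ^ p ∂μ
      = (∫⁻ ω, (increment (N e) t h ω : ℝ≥0∞) ^ p ∂μ).toReal := by
    intro h p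
    rw [integral_eq_lintegral_of_nonneg_ae (Eventually.of_forall fun ω => by positivity)
      ((hmeas h).pow_const p).aestronglyMeasurable]
    congr 1
    refine lintegral_congr fun ω => ?_
    rw [ENNReal.ofReal_pow (Nat.cast_nonneg _), ENNReal.ofReal_natCast]
  have hmem : ∀ᶠ h in 𝓝[>] (0 : ℝ≥0), MemLp (fun ω => (increment (N e) t h ω : ℝ)) 2 μ := by
    filter_upwards [hfin] with h hh
    refine (memLp_two_iff_integrable_sq (hmeas h).aestronglyMeasurable).2
      ⟨((hmeas h).pow_const 2).aestronglyMeasurable, ?_⟩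
    rw [hasFiniteIntegral_iff_ofReal (Eventually.of_forall fun ω => by positivity)]
    refine lt_of_eq_of_lt (lintegral_congr fun ω => ?_) hh.lt_top
    rw [ENNReal.ofReal_pow (Nat.cast_nonneg _), ENNReal.ofReal_natCast]
  have hr1 : Tendsto (fun h : ℝ≥0 => (h : ℝ)⁻¹ * ∫ ω, (increment (N e) t h ω : ℝ) ∂μ)
      (𝓝[>] 0) (𝓝 (rateMoment (fun e => q e x) e 1).toReal) := by
    refine ((ENNReal.tendsto_toReal hm₁).comp h1).congr fun h => ?_
    have := hint h 1
    simp only [pow_one] at this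
    rw [this, Function.comp_apply, ENNReal.toReal_div, ENNReal.coe_toReal, div_eq_inv_mul]
  have hr2 : Tendsto (fun h : ℝ≥0 => (h : ℝ)⁻¹ * ∫ ω, (increment (N e) t h ω : ℝ) ^ 2 ∂μ)
      (𝓝[>] 0) (𝓝 (rateMoment (fun e => q e x) e 2).toReal) := by
    refine ((ENNReal.tendsto_toReal hm₂).comp h2).congr fun h => ?_
    rw [hint h 2, Function.comp_apply, ENNReal.toReal_div, ENNReal.coe_toReal, div_eq_inv_mul]
  have hrv : Tendsto (fun h : ℝ≥0 => (h : ℝ)⁻¹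
      * variance (fun ω => (increment (N e) t h ω : ℝ)) μ)
      (𝓝[>] 0) (𝓝 (rateMoment (fun e => q e x) e 2).toReal) := by
    have hh : Tendsto (fun h : ℝ≥0 => (h : ℝ)) (𝓝[>] 0) (𝓝 0) := by
      have : Tendsto (fun h : ℝ≥0 => (h : ℝ)) (𝓝 0) (𝓝 ((0 : ℝ≥0) : ℝ)) :=
        NNReal.continuous_coe.tendsto 0
      exact this.mono_left nhdsWithin_le_nhds
    have := hr2.sub (hh.mul (hr1.pow 2))
    rw [zero_mul, sub_zero] at this
    refine this.congr' ?_
    filter_upwards [hmem, self_mem_nhdsWithin] with h hL hpos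
    have hpos' : (h : ℝ) ≠ 0 := by exact_mod_cast (ne_of_gt hpos)
    rw [variance_eq_sub hL]
    simp only [Pi.pow_apply]
    field_simp
  constructor
  · rintro ⟨-, m, v, hm, hv, hm0, hD⟩
    have e1 := tendsto_nhds_unique hm hr1
    have e2 := tendsto_nhds_unique hv hrv
    subst e1 e2
    exact ⟨hm0, hD⟩
  · rintro ⟨hm0, hD⟩
    exact ⟨hmem, _, _, hr1, hrv, hm0, hD⟩

lemma rateMoment_one_eq_two {q : Transition C → ℕ+ → ℝ≥0} {e : Transition C}
    (h : ∀ k : ℕ+, 2 ≤ (k : ℕ) → q e k = 0) : rateMoment q e 1 = rateMoment q e 2 := by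
  refine tsum_congr fun k => ?_
  by_cases hk : 2 ≤ (k : ℕ)
  · simp [h k hk]
  · have : (k : ℕ) = 1 := by have := k.pos; omega
    simp [this]

lemma rateMoment_one_lt_two {q : Transition C → ℕ+ → ℝ≥0} {e : Transition C} {k : ℕ+}
    (hk : 2 ≤ (k : ℕ)) (hq : q e k ≠ 0) (hfin : rateMoment q e 2 ≠ ∞) :
    rateMoment q e 1 < rateMoment q e 2 := by
  refine ENNReal.tsum_lt_tsum (i := k)
    (ne_top_of_le_ne_top hfin (rateMoment_mono q e (by norm_num))) (fun k => ?_) ?_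
  · gcongr
    · exact Nat.one_le_cast.2 k.pos
    · norm_num
  · have h1 : ((k : ℕ) : ℝ≥0) ^ 1 * q e k < ((k : ℕ) : ℝ≥0) ^ 2 * q e k := by
      have hq' : 0 < q e k := pos_of_ne_zero hq
      gcongr
      · exact_mod_cast hk
      · norm_num
    exact_mod_cast h1

lemma isSimpleAt_iff [IsProbabilityMeasure P] (hM : IsMarkovCountingSystem P X N)
    (hSC : IsStableConservative P X N q lam) (hK : MarkovFrom X N K P 0) {e : Transition C}
    {x : Fin C → ℤ} (hp : IsPossible P X t x) :
    IsSimpleAt P X (N e) x ↔ ∀ k : ℕ+, 2 ≤ (k : ℕ) → q e x k = 0 := by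
  have hR := isRegularState_of_isPossible hM hSC hK hp
  exact ⟨fun h _ hk => hK.rate_eq_zero_of_isSimpleAt hM hR hp h hk, fun h => hK.isSimpleAt hM hR h⟩

/-- Either side forces some nonzero rate, so no assumption of non-degeneracy is needed here. -/
lemma isOverDispersedAt_iff_isCompoundAt [IsProbabilityMeasure P]
    (hM : IsMarkovCountingSystem P X N)
    (hSC : IsStableConservative P X N q lam) (hP4 : PropertyP4 P X N lam) (e : Transition C)
    {x : Fin C → ℤ} (hp : IsPossible P X t x) :
    IsOverDispersedAt P X (N e) t x ↔ IsCompoundAt P X (N e) x := by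
  obtain ⟨K, hK⟩ := hM.exists_markovFrom
  obtain ⟨hm₂, -⟩ := tendsto_moments hM hSC hP4 hK e hp
  rw [IsCompoundAt, isSimpleAt_iff hM hSC hK hp, IsOverDispersedAt]
  simp only [hasDispersionIndex_iff hM hSC hP4 hK e hp]
  constructor
  · rintro ⟨_, ⟨h0, rfl⟩, h1⟩ hq
    have heq := rateMoment_one_eq_two (q := fun e => q e x) hq
    rw [← heq, div_self h0] at h1
    exact lt_irrefl _ h1
  · intro hq
    push Not at hq
    obtain ⟨k, hk, hqk⟩ := hq
    have hlt := rateMoment_one_lt_two (q := fun e => q e x) hk hqk hm₂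
    have h1 : rateMoment (fun e => q e x) e 1 ≠ 0 := fun h0 => by
      have := ENNReal.tsum_eq_zero.1 h0 k
      simp [hqk] at this
    have hpos : 0 < (rateMoment (fun e => q e x) e 1).toReal :=
      ENNReal.toReal_pos h1 hlt.ne_top
    refine ⟨_, ⟨hpos.ne', rfl⟩, (one_lt_div hpos).2 ?_⟩
    exact (ENNReal.toReal_lt_toReal hlt.ne_top hm₂).2 hlt

lemma isEquiDispersedAt_iff_isSimpleAt [IsProbabilityMeasure P]
    (hM : IsMarkovCountingSystem P X N)
    (hSC : IsStableConservative P X N q lam) (hP4 : PropertyP4 P X N lam) (e : Transition C)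
    {x : Fin C → ℤ} (hp : IsPossible P X t x) (hnd : ∃ k, q e x k ≠ 0) :
    IsEquiDispersedAt P X (N e) t x ↔ IsSimpleAt P X (N e) x := by
  obtain ⟨K, hK⟩ := hM.exists_markovFrom
  obtain ⟨hm₂, -⟩ := tendsto_moments hM hSC hP4 hK e hp
  obtain ⟨k, hqk⟩ := hnd
  have h1 : rateMoment (fun e => q e x) e 1 ≠ 0 := fun h0 => by
    have := ENNReal.tsum_eq_zero.1 h0 k
    simp [hqk] at this
  have hm₁ : rateMoment (fun e => q e x) e 1 ≠ ∞ :=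
    ne_top_of_le_ne_top hm₂ (rateMoment_mono _ _ (by norm_num))
  have hpos := ENNReal.toReal_pos h1 hm₁
  rw [isSimpleAt_iff hM hSC hK hp, IsEquiDispersedAt, hasDispersionIndex_iff hM hSC hP4 hK e hp]
  constructor
  · rintro ⟨-, h⟩ k hk
    by_contra hq
    have hlt := (ENNReal.toReal_lt_toReal hm₁ hm₂).2
      (rateMoment_one_lt_two (q := fun e => q e x) hk hq hm₂)
    rw [eq_div_iff hpos.ne', one_mul] at h
    exact hlt.ne h
  · intro hq
    rw [← rateMoment_one_eq_two (q := fun e => q e x) hq]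
    exact ⟨hpos.ne', (div_self hpos.ne').symm⟩

end Dispersion

theorem mainTheorem2 {C : ℕ} {Ω : Type*} [MeasurableSpace Ω] (P : Measure Ω)
    [IsProbabilityMeasure P] (X : ℝ≥0 → Ω → (Fin C → ℤ)) (N : Transition C → ℝ≥0 → Ω → ℕ)
    (q : Transition C → (Fin C → ℤ) → ℕ+ → ℝ≥0) (lam : (Fin C → ℤ) → ℝ≥0)
    (hMCS : IsMarkovCountingSystem P X N) (hSC : IsStableConservative P X N q lam)
    (hP3 : PropertyP3 P X N lam) (hP4 : PropertyP4 P X N lam) (e : Transition C) :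
    -- state by state: over-dispersed exactly when compound
    (∀ t x, IsPossible P X t x →
      (IsOverDispersedAt P X (N e) t x ↔ IsCompoundAt P X (N e) x)) ∧
    -- state by state, where events occur at all: equi-dispersed exactly when simple
    (∀ t x, IsPossible P X t x → (∃ k, q e x k ≠ 0) →
      (IsEquiDispersedAt P X (N e) t x ↔ IsSimpleAt P X (N e) x)) ∧
    -- the whole process is compound exactly when it is over-dispersed at some state
    (IsCompoundCounting P (N e) ↔
      ∃ t x, IsPossible P X t x ∧ IsOverDispersedAt P X (N e) t x) ∧
    -- the whole process is simple exactly when it is equi-dispersed at every state, events permitting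
    (IsSimpleCounting P (N e) ↔
      ∀ t x, IsPossible P X t x → (∃ k, q e x k ≠ 0) → IsEquiDispersedAt P X (N e) t x) := by
  have hover : ∀ t x, IsPossible P X t x →
      (IsOverDispersedAt P X (N e) t x ↔ IsCompoundAt P X (N e) x) := fun t x hp =>
    isOverDispersedAt_iff_isCompoundAt hMCS hSC hP4 e hp
  have hequi : ∀ t x, IsPossible P X t x → (∃ k, q e x k ≠ 0) →
      (IsEquiDispersedAt P X (N e) t x ↔ IsSimpleAt P X (N e) x) := fun t x hp hnd =>
    isEquiDispersedAt_iff_isSimpleAt hMCS hSC hP4 e hp hnd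
  have hsimple : IsSimpleCounting P (N e) ↔ ∀ t x, IsPossible P X t x → IsSimpleAt P X (N e) x :=
    ⟨fun h _ _ _ => h.mono fun _ hω s _ => hω s, hMCS.isSimpleCounting⟩
  refine ⟨hover, hequi, ?_, ?_⟩
  · rw [IsCompoundCounting, hsimple]
    push Not
    exact exists_congr fun t => exists_congr fun x => and_congr_right fun hp => (hover t x hp).symm
  · rw [hsimple]
    refine ⟨fun h t x hp hnd => (hequi t x hp hnd).2 (h t x hp), fun h t x hp => ?_⟩
    by_cases hnd : ∃ k, q e x k ≠ 0
    · exact (hequi t x hp hnd).1 (h t x hp hnd)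
    -- A degenerate state has no dispersion index, but with all rates zero it is simple anyway.
    · push Not at hnd
      obtain ⟨K, hK⟩ := hMCS.exists_markovFrom
      exact (isSimpleAt_iff hMCS hSC hK hp).2 fun k _ => hnd k
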